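/- **Setting.** Let $d\in\{2,3\}$ and let $\mathcal T_h$ be a finite conforming triangulation (no hanging nodes) of a polygonal/polyhedral domain $\Omega\subset\mathbb R^d$ into $d$-simplices. Let $\mathcal E_h=\mathcal E_h^o\cup\mathcal E_h^\partial$ be the set of its edges ($d=2$) or faces ($d=3$), split into interior ones (shared by two elements) and boundary ones (contained in one element). Let $\kappa$ be constant, equal to $\kappa_T>0$, on each $T\in\mathcal T_h$, let $\alpha>0$ and $\theta\in\{-1,0,1\}$. For $e\in\mathcal E_h^o$ label the two elements sharing $e$ by $T^+,T^-$ (arbitrarily), with outward unit normals $\mathbf n^\pm$ on $e$; for $e\in\mathcal E_h^\partial$ let $T$ be the element containing $e$, with outward unit normal $\mathbf n$. Superscripts $\pm$ denote restrictions to $T^\pm$. On $e\in\mathcal E_h^o$ put $$[\![v]\!]=v^+\mathbf n^++v^-\mathbf n^-,\quad \{\zeta\}_{\delta_e}=\delta_e\zeta^++(1-\delta_e)\zeta^-,\quad \beta_e=\frac{\kappa^-}{\kappa^++\kappa^-},\quad \kappa_e=\frac{2\kappa^+\kappa^-}{\kappa^++\kappa^-},$$ and on $e\in\mathcal E_h^\partial$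 put $[\![v]\!]=v\,\mathbf n$, $\{\zeta\}_{\delta_e}=\zeta$, $\kappa_e=\kappa_T$. Let $h_e$ be the $(d-1)$-dimensional Lebesgue measure of $e$, $m_e$ its mass center, and $\mathcal P^0_e f$ the mean value of $f$ over $e$. Let $V_h^{DG}$ be the space of discontinuous functions on $\Omega$ that are affine on each element. For $v,w\in V_h^{DG}$ define the IP($\beta$)-0 bilinear form $$\mathcal A_0(v,w)=\sum_{T\in\mathcal T_h}\int_T\kappa\nabla v\cdot\nabla w\,dx+\sum_{e\in\mathcal E_h}\int_e\Big(-\{\kappa\nabla v\}_{\beta_e}\cdot[\![w]\!]+\theta\,[\![v]\!]\cdot\{\kappa\nabla w\}_{\beta_e}+\alpha h_e^{-1}\kappa_e\,\mathcal P^0_e([\![v]\!])\cdot[\![w]\!]\Big)ds,$$ and define the spaces $$V_h^{CR}=\{v\in V_h^{DG}:\mathcal P^0_e([\![v]\!]\cdot\mathbf n)=0\ \ \forall e\in\mathcal E_h\},\qquad \mathcal Z_\beta=\{z\in V_h^{DG}:\mathcal P^0_e(\{z\}_{1-\beta_e})=0\ \ \forall e\in\mathcal E_h^o\},$$ where $\mathbf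 n$ is a unit normal of $e$. For a face $e$ of an element $T$ let $\varphi_{e,T}$ be the function that is affine on $T$, equal to $1$ at $m_e$ and to $0$ at the mass centers of the other faces of $T$, and zero outside $T$. Put $\varphi_e^{CR}=\varphi_{e,T^+}+\varphi_{e,T^-}$ and $\psi_e^z=\beta_e\varphi_{e,T^+}-(1-\beta_e)\varphi_{e,T^-}$ for $e\in\mathcal E_h^o$, and $\psi_e^z=\varphi_{e,T}$ for $e\in\mathcal E_h^\partial$. **Lemma.** 1. $\mathcal A_0(v,z)=0$ for all $v\in V_h^{CR}$ and all $z\in\mathcal Z_\beta$. 2. $V_h^{DG}=V_h^{CR}\oplus\mathcal Z_\beta$. The $\psi_e^z$ ($e\in\mathcal E_h$) span $\mathcal Z_\beta$, the $\varphi_e^{CR}$ ($e\in\mathcal E_h^o$) span $V_h^{CR}$, and together they form a basis of $V_h^{DG}$. In this basis (the $\psi^z_e$ first; rows indexed by test functions, columns by trial functions) the stiffness matrix of $\mathcal A_0$ is block lower triangular, $$\mathbb A_0=\begin{bmatrix}\mathbb A_0^{zz}&0\\ \mathbb A_0^{vz}&\mathbb A_0^{vv}\end{bmatrix},$$ with $(\mathbb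 A_0^{zz})_{e'e}=\mathcal A_0(\psi_e^z,\psi_{e'}^z)$, $(\mathbb A_0^{vz})_{e'e}=\mathcal A_0(\psi_e^z,\varphi_{e'}^{CR})$ and $(\mathbb A_0^{vv})_{e'e}=\mathcal A_0(\varphi_e^{CR},\varphi_{e'}^{CR})$. 3. For $\theta=-1$ the form $\mathcal A_0$ is symmetric on $V_h^{DG}$. Whenever $\mathcal A_0$ is symmetric, the decomposition $V_h^{DG}=V_h^{CR}\oplus\mathcal Z_\beta$ is $\mathcal A_0$-orthogonal: $\mathcal A_0(v,z)=\mathcal A_0(z,v)=0$ for all $v\in V_h^{CR}$, $z\in\mathcal Z_\beta$. -/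

import Mathlib

open MeasureTheory
open scoped InnerProductSpace Gradient

noncomputable section

namespace IPDG

/-- `d`-dimensional Euclidean space. -/
abbrev Space (d : ℕ) : Type := EuclideanSpace ℝ (Fin d)

/-- A conforming triangulation (without hanging nodes) by `d`-simplices: a finite simplicial complex
in `ℝ^d`, each simplex given by its set of vertices, in which every simplex is a face of a
`d`-simplex. The triangulated domain `Ω` is the interior of `toSimplicialComplex.space`. -/
structure SimplicialMesh (d : ℕ) extends Geometry.SimplicialComplex ℝ (Space d) where
  /-- There are finitely many simplices. -/
  finite_faces : faces.Finite
  /-- Every simplex is a face of a `d`-simplex. -/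
  pure : ∀ s ∈ faces, ∃ T ∈ faces, s ⊆ T ∧ T.card = d + 1

variable {d : ℕ}

namespace SimplicialMesh

variable (M : SimplicialMesh d)

/-- The elements `T ∈ 𝒯_h`, as vertex sets. -/
def Elem : Type := {T : Finset (Space d) // T ∈ M.faces ∧ T.card = d + 1}

/-- The set `ℰ_h` of all faces (edges if `d = 2`), as vertex sets. -/
def Face : Type := {e : Finset (Space d) // e ∈ M.faces ∧ e.card = d}

/-- A face is interior if it is shared by two different elements; otherwise it is
a boundary face. -/
def IsInterior (e : M.Face) : Prop :=
  ∃ T T' : M.Elem, T ≠ T' ∧ e.1 ⊆ T.1 ∧ e.1 ⊆ T'.1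

/-- The set `ℰ_h^o` of interior faces. -/
def InteriorFace : Type := {e : M.Face // M.IsInterior e}

instance : Fintype M.Elem :=
  @Fintype.ofFinite _ (M.finite_faces.subset (fun _ h => h.1)).to_subtype

instance : Fintype M.Face :=
  @Fintype.ofFinite _ (M.finite_faces.subset (fun _ h => h.1)).to_subtype

instance : Fintype M.InteriorFace :=
  @Fintype.ofFinite _ (Subtype.finite (p := M.IsInterior))

instance : DecidableEq M.Elem := Classical.decEq _

instance : DecidableEq M.Face := Classical.decEq _

instance : DecidableEq M.InteriorFace := Classical.decEq _

variable {M}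

/-- The closed simplex with the given vertices. -/
def Elem.body (T : M.Elem) : Set (Space d) := convexHull ℝ (T.1 : Set (Space d))

/-- The closed face with the given vertices. -/
def Face.body (e : M.Face) : Set (Space d) := convexHull ℝ (e.1 : Set (Space d))

/-- The mass center `m_e` of a face. -/
def Face.center (e : M.Face) : Space d := e.1.centroid ℝ id

/-- `∫_e f ds`, with respect to the `(d-1)`-dimensional Lebesgue measure on `e`. -/
def Face.integral (e : M.Face) (f : Space d → ℝ) : ℝ := ∫ x in e.body, f x ∂μHE[d - 1]

/-- `h_e`, the `(d-1)`-dimensional Lebesgue measure of `e`. -/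
def Face.size (e : M.Face) : ℝ := (μHE[d - 1] : Measure (Space d)).real e.body

/-- The `L²(e)`-projection `𝒫_e^0` onto the constants: the mean value on `e`. -/
def Face.P0 {F : Type*} [NormedAddCommGroup F] [NormedSpace ℝ F] (e : M.Face)
    (f : Space d → F) : F :=
  ⨍ x in e.body, f x ∂μHE[d - 1]

/-- For a face `e` of `T`, the unit normal vector of `T` on `e` that points out of `T`: the normalized
component orthogonal to `e` of the vector from the barycenter of `T` to that of `e`. -/
def Elem.normal (T : M.Elem) (e : M.Face) : Space d :=
  let ν := (vectorSpan ℝ (e.1 : Set (Space d)))ᗮ.starProjection (e.center - T.1.centroid ℝ id)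
  ‖ν‖⁻¹ • ν

/-- The barycentric coordinate system of an element. -/
def Elem.affineBasis (T : M.Elem) : AffineBasis T.1 ℝ (Space d) :=
  ⟨Subtype.val, M.indep T.2.1, by
    rw [(M.indep T.2.1).affineSpan_eq_top_iff_card_eq_finrank_add_one]
    simp [T.2.2]⟩

open Classical in
/-- For a face `e` of `T`, the local Crouzeix-Raviart basis function `φ_{e,T}` on `T`, which is
`1 - d λ_a` with the barycentric coordinate `λ_a` of the vertex `a` of `T` opposite to `e`. -/
def Elem.crLocal (T : M.Elem) (e : M.Face) : Space d →ᵃ[ℝ] ℝ :=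
  AffineMap.const ℝ (Space d) 1 -
    (d : ℝ) • ∑ a : T.1, if a.1 ∈ e.1 then 0 else T.affineBasis.coord a

/-- The defining property of `φ_{e,T}`: it is `1` at the mass center of `e` and `0` at the mass
centers of the other faces of `T`. -/
theorem Elem.crLocal_center (T : M.Elem) (e e' : M.Face) (hd : d ≠ 0) (he : e.1 ⊆ T.1)
    (he' : e'.1 ⊆ T.1) : T.crLocal e e'.center = if e' = e then 1 else 0 := by
  classical
  have hd' : (d : ℝ) ≠ 0 := by exact_mod_cast hd
  have key : ∀ a : T.1, T.affineBasis.coord a e'.center = if a.1 ∈ e'.1 then (d : ℝ)⁻¹ else 0 := by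
    intro a
    have hw : ∑ i ∈ e'.1, e'.1.centroidWeights ℝ i = 1 :=
      e'.1.sum_centroidWeights_eq_one_of_card_ne_zero ℝ (by rw [e'.2.2]; exact hd)
    rw [Face.center, Finset.centroid_def, Finset.map_affineCombination _ _ _ hw,
      Finset.affineCombination_eq_linear_combination _ _ _ hw]
    have hc : ∀ i ∈ e'.1, e'.1.centroidWeights ℝ i • (T.affineBasis.coord a ∘ id) i
        = if i = a.1 then (d : ℝ)⁻¹ else 0 := by
      intro i hi
      have h1 : T.affineBasis.coord a (T.affineBasis ⟨i, he' hi⟩) = if a = ⟨i, he' hi⟩ then 1 else 0 :=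
        T.affineBasis.coord_apply a ⟨i, he' hi⟩
      have h2 : T.affineBasis ⟨i, he' hi⟩ = i := rfl
      rw [h2] at h1
      simp only [Function.comp_apply, id, h1, Finset.centroidWeights_apply, e'.2.2, smul_eq_mul]
      by_cases h : i = a.1
      · subst h; simp
      · rw [if_neg h, if_neg (fun h' => h (by rw [h'])), mul_zero]
    rw [Finset.sum_congr rfl hc, Finset.sum_ite_eq']
  have hsum : (∑ a : T.1, if a.1 ∈ e.1 then (0 : ℝ) else T.affineBasis.coord a e'.center)
      = ((e'.1 \ e.1).card : ℝ) * (d : ℝ)⁻¹ := by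
    have : ∀ a : T.1, (if a.1 ∈ e.1 then (0 : ℝ) else T.affineBasis.coord a e'.center)
        = (fun i => if i ∈ e'.1 \ e.1 then (d : ℝ)⁻¹ else 0) a.1 := by
      intro a
      simp only [key, Finset.mem_sdiff]
      split_ifs <;> simp_all
    rw [Finset.sum_congr rfl (fun a _ => this a),
      Finset.sum_coe_sort T.1 (fun i => if i ∈ e'.1 \ e.1 then (d : ℝ)⁻¹ else 0),
      Finset.sum_ite_mem, Finset.inter_eq_right.2 (Finset.sdiff_subset.trans he'),
      Finset.sum_const, nsmul_eq_mul]
  have hval : T.crLocal e e'.center = 1 - (d : ℝ) *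
      ∑ a : T.1, if a.1 ∈ e.1 then (0 : ℝ) else T.affineBasis.coord a e'.center := by
    have hz : ∀ s : Finset T.1,
        (∑ a ∈ s, if a.1 ∈ e.1 then (0 : Space d →ᵃ[ℝ] ℝ) else T.affineBasis.coord a) e'.center
          = ∑ a ∈ s, if a.1 ∈ e.1 then (0 : ℝ) else T.affineBasis.coord a e'.center := by
      intro s
      induction s using Finset.induction_on with
      | empty => simp
      | insert a s ha ih =>
        rw [Finset.sum_insert ha, Finset.sum_insert ha, AffineMap.coe_add, Pi.add_apply, ih]
        split_ifs <;> rfl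
    rw [← hz]
    simp [crLocal]
  rw [hval, hsum]
  by_cases h : e' = e
  · simp [h]
  · have h1 : (e'.1 \ e.1).card ≤ 1 := by
      calc _ ≤ (T.1 \ e.1).card := Finset.card_le_card (Finset.sdiff_subset_sdiff he' le_rfl)
        _ = 1 := by rw [Finset.card_sdiff_of_subset he, T.2.2, e.2.2]; omega
    have h2 : (e'.1 \ e.1).card ≠ 0 := by
      intro h0
      rw [Finset.card_eq_zero, Finset.sdiff_eq_empty_iff_subset] at h0
      exact h (Subtype.ext (Finset.eq_of_subset_of_card_le h0 (by rw [e.2.2, e'.2.2])))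
    have h3 : (e'.1 \ e.1).card = 1 := by omega
    rw [h3, if_neg h]
    simp [hd']

variable (M)

/-- The space `V_h^DG` of discontinuous piecewise linear functions: an affine function on every
element. (An affine function on `ℝ^d` is determined by its restriction to a `d`-simplex,
and the elements cover `Ω` and overlap only in null sets.) -/
abbrev DG : Type := M.Elem → (Space d →ᵃ[ℝ] ℝ)

/-- A choice, for every interior face `e`, which of the two elements sharing `e` is called `T⁺` and
which is called `T⁻`. For a boundary face, `T⁺` is the only element that contains it. -/
structure Labelling where
  plus : M.Face → M.Elem
  minus : M.InteriorFace → M.Elem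
  subset_plus : ∀ e : M.Face, e.1 ⊆ (plus e).1
  subset_minus : ∀ e : M.InteriorFace, e.1.1 ⊆ (minus e).1
  plus_ne_minus : ∀ e : M.InteriorFace, plus e.1 ≠ minus e

namespace Labelling

variable {M} (L : M.Labelling)

open Classical in
/-- The jump `⟦v⟧ = v⁺ n⁺ + v⁻ n⁻` on interior faces, `⟦v⟧ = v n` on boundary faces. -/
def jump (v : M.DG) (e : M.Face) (x : Space d) : Space d :=
  if h : M.IsInterior e then
    v (L.plus e) x • (L.plus e).normal e + v (L.minus ⟨e, h⟩) x • (L.minus ⟨e, h⟩).normal e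
  else v (L.plus e) x • (L.plus e).normal e

open Classical in
/-- The weighted average `{ζ}_δ = δ_e ζ⁺ + (1 - δ_e) ζ⁻` on interior faces, `{ζ}_δ = ζ` on boundary
faces, of an elementwise defined, scalar or vector valued function `ζ`. -/
def avg {F : Type*} [AddCommGroup F] [Module ℝ F] (δ : M.InteriorFace → ℝ)
    (ζ : M.Elem → Space d → F) (e : M.Face) (x : Space d) : F :=
  if h : M.IsInterior e then
    δ ⟨e, h⟩ • ζ (L.plus e) x + (1 - δ ⟨e, h⟩) • ζ (L.minus ⟨e, h⟩) x
  else ζ (L.plus e) x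

/-- The weight `β_e = κ⁻ / (κ⁺ + κ⁻)`. -/
def beta (κ : M.Elem → ℝ) (e : M.InteriorFace) : ℝ :=
  κ (L.minus e) / (κ (L.plus e.1) + κ (L.minus e))

open Classical in
/-- The face coefficient `κ_e`: the harmonic mean of `κ⁺` and `κ⁻` on interior faces, the value
of `κ` on the adjacent element on boundary faces. -/
def kappaFace (κ : M.Elem → ℝ) (e : M.Face) : ℝ :=
  if h : M.IsInterior e then
    2 * κ (L.plus e) * κ (L.minus ⟨e, h⟩) / (κ (L.plus e) + κ (L.minus ⟨e, h⟩))
  else κ (L.plus e)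

/-- The elementwise flux `κ ∇_h v`. -/
def flux (κ : M.Elem → ℝ) (v : M.DG) (T : M.Elem) (x : Space d) : Space d :=
  κ T • ∇ (v T) x

/-- The bilinear form `𝒜₀` of the IP(β)-0 method with penalty parameter `α`. -/
def A0 (κ : M.Elem → ℝ) (α θ : ℝ) (v w : M.DG) : ℝ :=
  ∑ T : M.Elem, (∫ x in T.body, ⟪flux κ v T x, ∇ (w T) x⟫_ℝ)
    - ∑ e : M.Face, e.integral (fun x => ⟪L.avg (L.beta κ) (flux κ v) e x, L.jump w e x⟫_ℝ)
    + θ * ∑ e : M.Face, e.integral (fun x => ⟪L.jump v e x, L.avg (L.beta κ) (flux κ w) e x⟫_ℝ)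
    + ∑ e : M.Face, e.integral (fun x =>
        ⟪(α * (e.size)⁻¹ * L.kappaFace κ e) • e.P0 (L.jump v e), L.jump w e x⟫_ℝ)

/-- The Crouzeix-Raviart space `V_h^CR` (with zero mean values on the boundary faces). -/
def VCR : Set M.DG :=
  {v | ∀ e : M.Face, e.P0 (fun x => ⟪L.jump v e x, (L.plus e).normal e⟫_ℝ) = 0}

/-- The space `𝒵_β`. -/
def Zbeta (κ : M.Elem → ℝ) : Set M.DG :=
  {z | ∀ e : M.InteriorFace,
    e.1.P0 (L.avg (fun e => 1 - L.beta κ e) (fun T x => z T x) e.1) = 0}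

/-- The function `φ_{e,T}` on `T`, extended by zero to the other elements. -/
def localBasis (e : M.Face) (T : M.Elem) : M.DG := Pi.single T (T.crLocal e)

/-- The Crouzeix-Raviart basis function `φ_e^CR = φ_e⁺ + φ_e⁻`. -/
def phiCR (e : M.InteriorFace) : M.DG :=
  localBasis e.1 (L.plus e.1) + localBasis e.1 (L.minus e)

open Classical in
/-- The basis function `ψ_e^z` of `𝒵_β`: `β_e φ_e⁺ - (1 - β_e) φ_e⁻` on interior faces
and `φ_e` on boundary faces. -/
def psiZ (κ : M.Elem → ℝ) (e : M.Face) : M.DG :=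
  if h : M.IsInterior e then
    L.beta κ ⟨e, h⟩ • localBasis e (L.plus e)
      - (1 - L.beta κ ⟨e, h⟩) • localBasis e (L.minus ⟨e, h⟩)
  else localBasis e (L.plus e)

/-- The stiffness matrix of `𝒜₀` in a basis of `V_h^DG`: the row index is the test function. -/
def stiffness {ι : Type*} (κ : M.Elem → ℝ) (α θ : ℝ) (b : Module.Basis ι ℝ M.DG) :
    Matrix ι ι ℝ :=
  Matrix.of fun i j => L.A0 κ α θ (b j) (b i)

end Labelling

end SimplicialMesh

end IPDG

end

set_option linter.unusedSectionVars false

/-! Everything reduces to values at mass centers. The midpoint rule is exact for affine functions on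
a face, so jumps, averages and the form `A0` depend only on element gradients and on the numbers `v
T m_e` (`Face.integral_affineMap`, `A0_eq`). On each element an affine function is the combination
of the local Crouzeix-Raviart functions with these numbers as coefficients.

For part 1, a Crouzeix-Raviart `v` has vanishing mean jumps, which removes the penalty and the `θ`
term. The divergence theorem on each `T` turns the volume term into a sum over faces of `|e| (a z⁺ -
b z⁻)`, where `a`, `b` are the components of `κ∇v⁺`, `κ∇v⁻` along `n⁺`. The identity `a z⁺ - b z⁻ =
(β a + (1-β) b)(z⁺ - z⁻) + (a - b)((1-β) z⁺ + β z⁻)` splits this into the consistency term, which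
cancels, and a multiple of the mean of `{z}_{1-β}`, which vanishes on `Zbeta`. On a boundary face
the two terms agree directly.

For part 2, the mean jumps on all faces and the mean averages on interior faces form a coordinate
system of `V_h^DG` (`coordMap`), to which the `ψ_e^z` and `φ_e^CR` are dual. The two spaces are the
kernels of the two halves of the coordinates. Part 3 follows from part 1 by symmetry.

The geometric input is proved from the Hausdorff measure: slicing a simplex parallel to a facet
gives its volume and the divergence theorem, and exchanging two vertices gives the midpoint rule.
The intersection axiom of a simplicial complex puts elements with a common face on opposite sides of
it. -/

noncomputable section

open Module

/-! ### Gradients of affine functions, and the volume of a simplex by slicing. -/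

section AffineGeometry

variable {E : Type*} [NormedAddCommGroup E] [InnerProductSpace ℝ E] [FiniteDimensional ℝ E]

/-- The constant gradient of an affine function. -/
def AffineMap.gradVec (f : E →ᵃ[ℝ] ℝ) : E :=
  (InnerProductSpace.toDual ℝ E).symm (LinearMap.toContinuousLinearMap f.linear)

theorem AffineMap.inner_gradVec (f : E →ᵃ[ℝ] ℝ) (y : E) : ⟪f.gradVec, y⟫_ℝ = f.linear y := by
  simp [AffineMap.gradVec]

theorem AffineMap.gradient_eq_gradVec (f : E →ᵃ[ℝ] ℝ) (x : E) : ∇ (f : E → ℝ) x = f.gradVec := by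
  have h : HasFDerivAt (f : E → ℝ) (LinearMap.toContinuousLinearMap f.linear) x := by
    have h1 : (f : E → ℝ) = fun y => (LinearMap.toContinuousLinearMap f.linear) y + f 0 := by
      ext y
      exact congrFun (AffineMap.decomp f) y
    rw [h1]
    exact (LinearMap.toContinuousLinearMap f.linear).hasFDerivAt.add_const _
  rw [gradient, h.fderiv, AffineMap.gradVec]

theorem AffineMap.inner_gradVec_sub (f : E →ᵃ[ℝ] ℝ) (x y : E) :
    ⟪f.gradVec, x - y⟫_ℝ = f x - f y := by
  rw [AffineMap.inner_gradVec]
  exact AffineMap.linearMap_vsub f x y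

theorem AffineMap.apply_add_smul_sub (f : E →ᵃ[ℝ] ℝ) (c : ℝ) (x y z : E) :
    f (x + c • (y - z)) = f x + c * (f y - f z) := by
  have h1 : f (c • (y - z) +ᵥ x) = f.linear (c • (y - z)) +ᵥ f x := f.map_vadd x _
  have h2 : f.linear (y - z) = f y - f z := AffineMap.linearMap_vsub f y z
  rw [vadd_eq_add, vadd_eq_add, map_smul, h2, smul_eq_mul, add_comm, add_comm _ (f x)] at h1
  exact h1

theorem AffineMap.gradVec_add (f g : E →ᵃ[ℝ] ℝ) : (f + g).gradVec = f.gradVec + g.gradVec := by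
  refine ext_inner_right ℝ fun y => ?_
  simp [inner_add_left, AffineMap.inner_gradVec]

theorem AffineMap.gradVec_smul (c : ℝ) (f : E →ᵃ[ℝ] ℝ) : (c • f).gradVec = c • f.gradVec := by
  refine ext_inner_right ℝ fun y => ?_
  simp [inner_smul_left, AffineMap.inner_gradVec]

theorem AffineMap.gradVec_sum {ι : Type*} (s : Finset ι) (f : ι → E →ᵃ[ℝ] ℝ) :
    (∑ i ∈ s, f i).gradVec = ∑ i ∈ s, (f i).gradVec := by
  classical
  induction s using Finset.induction_on with
  | empty =>
    refine ext_inner_right ℝ fun y => ?_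
    simp [AffineMap.inner_gradVec]
  | insert a s ha ih => rw [Finset.sum_insert ha, Finset.sum_insert ha, AffineMap.gradVec_add, ih]

theorem AffineMap.continuous_real (f : E →ᵃ[ℝ] ℝ) : Continuous f :=
  AffineMap.continuous_of_finiteDimensional f

variable {ι : Type*} [Fintype ι] (B : AffineBasis ι ℝ E)

namespace AffineBasis

/-- The closed simplex spanned by an affine basis. -/
def simplex : Set E := {x | ∀ i, 0 ≤ B.coord i x}

/-- The facet of the simplex opposite to the vertex `B a`. -/
def facet (a : ι) : Set E := {x | B.coord a x = 0 ∧ ∀ i, 0 ≤ B.coord i x}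

theorem convexHull_range_eq_simplex : convexHull ℝ (Set.range B) = B.simplex :=
  B.convexHull_eq_nonneg_coord

theorem isClosed_simplex : IsClosed B.simplex := by
  rw [simplex, Set.ofPred_forall]
  exact isClosed_iInter fun i => isClosed_le continuous_const (B.coord i).continuous_real

theorem isClosed_facet (a : ι) : IsClosed (B.facet a) :=
  (isClosed_eq (B.coord a).continuous_real continuous_const).inter B.isClosed_simplex

theorem facet_subset_simplex (a : ι) : B.facet a ⊆ B.simplex := fun _ h => h.2

theorem isCompact_simplex : IsCompact B.simplex := by
  rw [← B.convexHull_range_eq_simplex]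
  exact (Set.finite_range B).isCompact_convexHull (𝕜 := ℝ)

theorem isCompact_facet (a : ι) : IsCompact (B.facet a) :=
  B.isCompact_simplex.of_isClosed_subset (B.isClosed_facet a) (B.facet_subset_simplex a)

theorem coord_le_one {x : E} (hx : x ∈ B.simplex) (a : ι) : B.coord a x ≤ 1 := by
  rw [← B.sum_coord_apply_eq_one x]
  exact Finset.single_le_sum (f := fun i => B.coord i x) (fun i _ => hx i) (Finset.mem_univ a)

theorem gradVec_coord_ne_zero [Nontrivial ι] (a : ι) : (B.coord a).gradVec ≠ 0 := by
  classical
  obtain ⟨b, hb⟩ := exists_ne a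
  intro h
  have := (B.coord a).inner_gradVec_sub (B a) (B b)
  rw [h, inner_zero_left, B.coord_apply_eq, B.coord_apply_ne hb.symm] at this
  norm_num at this

theorem coord_homothety (a i : ι) (c : ℝ) (x : E) :
    B.coord i (AffineMap.homothety (B a) c x) =
      B.coord i (B a) + c * (B.coord i x - B.coord i (B a)) := by
  rw [AffineMap.homothety_apply, vsub_eq_sub, vadd_eq_add, add_comm,
    AffineMap.apply_add_smul_sub]

/-- The slices of a simplex parallel to a facet are homothetic images of this facet. -/
theorem simplex_inter_slice (a : ι) {x : ℝ} (h0 : 0 < x) (h1 : x ≤ 1) :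
    B.simplex ∩ {y | B.coord a y = 1 - x} = AffineMap.homothety (B a) x '' B.facet a := by
  ext y
  constructor
  · rintro ⟨hy, hya⟩
    refine ⟨AffineMap.homothety (B a) x⁻¹ y, ?_, ?_⟩
    · have hya' : B.coord a y = 1 - x := hya
      refine ⟨?_, fun i => ?_⟩
      · rw [coord_homothety, B.coord_apply_eq, hya']
        field_simp
        ring
      · rw [coord_homothety]
        by_cases hi : i = a
        · subst hi
          rw [B.coord_apply_eq, hya']
          refine le_of_eq ?_
          field_simp
          ring
        · rw [B.coord_apply_ne hi]
          have := hy i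
          simp only [zero_add, sub_zero]
          positivity
    · change ((AffineMap.homothety (B a) x).comp (AffineMap.homothety (B a) x⁻¹)) y = y
      rw [← AffineMap.homothety_mul, mul_inv_cancel₀ h0.ne',
        AffineMap.homothety_one]
      rfl
  · rintro ⟨z, hz, rfl⟩
    refine ⟨fun i => ?_, ?_⟩
    · rw [coord_homothety]
      by_cases hi : i = a
      · subst hi
        rw [B.coord_apply_eq, hz.1]
        linarith
      · rw [B.coord_apply_ne hi]
        have := hz.2 i
        simp only [zero_add, sub_zero]
        positivity
    · change B.coord a _ = 1 - x
      rw [coord_homothety, hz.1, B.coord_apply_eq]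
      ring

section Measure

variable [MeasurableSpace E] [BorelSpace E]

/-- A slice at relative distance `x` from the vertex has `x ^ (d - 1)` times the measure of the
facet; integrating over `x` produces the factor `1 / d` in the volume formula. -/
theorem lintegral_pow_Ioc (n : ℕ) :
    ∫⁻ x in Set.Ioc (0 : ℝ) 1, ENNReal.ofReal (x ^ n) = ENNReal.ofReal (1 / (n + 1)) := by
  rw [← ofReal_integral_eq_lintegral_ofReal, ← intervalIntegral.integral_of_le zero_le_one,
    integral_pow]
  · simp
  · exact ((continuous_pow n).integrableOn_Icc (a := (0 : ℝ)) (b := 1)).mono_set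
      Set.Ioc_subset_Icc_self
  · filter_upwards [ae_restrict_mem measurableSet_Ioc] with x hx
    exact pow_nonneg hx.1.le n

/-- The volume of a simplex is the measure of a facet times its height, divided by the dimension. -/
theorem volume_simplex_eq [Nontrivial ι] (a : ι) :
    volume B.simplex = ENNReal.ofReal (‖(B.coord a).gradVec‖⁻¹ * (finrank ℝ E : ℝ)⁻¹) *
      (μHE[finrank ℝ E - 1] : Measure E) (B.facet a) := by
  set g := (B.coord a).gradVec with hg
  have hg0 : g ≠ 0 := B.gradVec_coord_ne_zero a
  have hgn : ‖g‖ ≠ 0 := norm_ne_zero_iff.2 hg0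
  have : Nontrivial E := ⟨g, 0, hg0⟩
  have hpos : 0 < finrank ℝ E := finrank_pos
  -- `v` is the height vector from `B a` to the hyperplane of the facet: the coordinate drops from 1
  -- to 0 along it, so `B a + x • v` lies on the level `1 - x`.
  set v : E := (-(‖g‖ ^ 2)⁻¹) • g with hv
  have hv0 : v ≠ 0 := smul_ne_zero (by simpa using hgn) hg0
  have hvn : ‖v‖ = ‖g‖⁻¹ := by
    rw [hv, norm_smul, norm_neg, norm_inv, norm_pow, norm_norm]
    field_simp
  have hslice : ∀ x : ℝ, B.simplex ∩ AffineSubspace.mk' (x • v +ᵥ B a) (ℝ ∙ v)ᗮ =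
      B.simplex ∩ {y | B.coord a y = 1 - x} := by
    intro x
    congr 1
    ext y
    have h1 : ⟪g, y - (x • v + B a)⟫_ℝ = B.coord a y - (1 - x) := by
      rw [show y - (x • v + B a) = (y - B a) - x • v by abel, inner_sub_right,
        AffineMap.inner_gradVec_sub, B.coord_apply_eq, hv, inner_smul_right, inner_smul_right,
        real_inner_self_eq_norm_sq]
      field_simp
      ring
    rw [SetLike.mem_coe, AffineSubspace.mem_mk', vsub_eq_sub, vadd_eq_add,
      Submodule.mem_orthogonal_singleton_iff_inner_right, hv, inner_smul_left, ← hv, h1]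
    simp [hgn, sub_eq_zero]
  have hae : ∀ᵐ x : ℝ, (μHE[finrank ℝ E - 1] : Measure E)
        (B.simplex ∩ AffineSubspace.mk' (x • v +ᵥ B a) (ℝ ∙ v)ᗮ) =
      (Set.Ioc (0 : ℝ) 1).indicator (fun x => ENNReal.ofReal (x ^ (finrank ℝ E - 1)) *
        (μHE[finrank ℝ E - 1] : Measure E) (B.facet a)) x := by
    -- At `x = 0` the slice is the vertex itself and the homothety degenerates; this one parameter
    -- is negligible.
    filter_upwards [Measure.ae_ne volume (0 : ℝ)] with x hx0
    rw [hslice]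
    by_cases hx : x ∈ Set.Ioc (0 : ℝ) 1
    · rw [Set.indicator_of_mem hx, B.simplex_inter_slice a hx.1 hx.2,
        euclideanHausdorffMeasure_homothety_image _ _ hx.1.ne', ENNReal.smul_def, smul_eq_mul]
      congr 1
      rw [ENNReal.coe_pow, ENNReal.ofReal_pow hx.1.le]
      congr 1
      rw [ENNReal.ofReal, Real.toNNReal_eq_nnnorm_of_nonneg hx.1.le]
    · rw [Set.indicator_of_notMem hx]
      have : B.simplex ∩ {y | B.coord a y = 1 - x} = ∅ := by
        rw [Set.eq_empty_iff_forall_notMem]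
        rintro y ⟨hy, hya⟩
        have hya' : B.coord a y = 1 - x := hya
        have h1 := hy a
        have h2 := B.coord_le_one hy a
        exact hx ⟨lt_of_le_of_ne (by linarith) (Ne.symm hx0), by linarith⟩
      rw [this, measure_empty]
  -- Cavalieri's principle along `v`; the parameter measures the height in units of `‖v‖ = ‖g‖⁻¹`,
  -- which supplies that factor.
  rw [← InnerProductSpace.euclideanHausdorffMeasure_eq_volume,
    EuclideanGeometry.euclideanHausdorffMeasure_eq_lintegral (B a) hv0
      B.isClosed_simplex.measurableSet, lintegral_congr_ae hae,
    lintegral_indicator measurableSet_Ioc, lintegral_mul_const _ (by fun_prop),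
    lintegral_pow_Ioc, ← mul_assoc]
  congr 1
  rw [← ofReal_norm, hvn, ← ENNReal.ofReal_mul (by positivity)]
  congr 2
  rw [Nat.cast_sub hpos]
  simp

theorem volume_simplex_pos : 0 < volume B.simplex := by
  rw [← B.convexHull_range_eq_simplex]
  refine lt_of_lt_of_le (isOpen_interior.measure_pos volume ?_) (measure_mono interior_subset)
  rw [interior_convexHull_nonempty_iff_affineSpan_eq_top]
  exact B.tot

/-- By the volume formula, a null facet would force a null simplex, and an infinite one an infinite
volume. Both bounds are needed to cancel the measure of a facet. -/
theorem measure_facet_ne_zero [Nontrivial ι] (a : ι) :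
    (μHE[finrank ℝ E - 1] : Measure E) (B.facet a) ≠ 0 := by
  intro h
  have := B.volume_simplex_pos
  rw [B.volume_simplex_eq a, h, mul_zero] at this
  exact lt_irrefl _ this

theorem measure_facet_ne_top [Nontrivial ι] (a : ι) :
    (μHE[finrank ℝ E - 1] : Measure E) (B.facet a) ≠ ⊤ := by
  intro h
  have h1 : volume B.simplex < ⊤ := B.isCompact_simplex.measure_lt_top
  have hg0 := B.gradVec_coord_ne_zero a
  have : Nontrivial E := ⟨_, _, hg0⟩
  have hpos : 0 < finrank ℝ E := finrank_pos
  rw [B.volume_simplex_eq a, h, ENNReal.mul_top] at h1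
  · exact lt_irrefl _ h1
  · rw [Ne, ENNReal.ofReal_eq_zero, not_le]
    have := norm_pos_iff.2 hg0
    positivity

theorem volume_real_simplex_mul [Nontrivial ι] (a : ι) :
    volume.real B.simplex * ((finrank ℝ E : ℝ) * ‖(B.coord a).gradVec‖) =
      (μHE[finrank ℝ E - 1] : Measure E).real (B.facet a) := by
  have hg0 := B.gradVec_coord_ne_zero a
  have : Nontrivial E := ⟨_, _, hg0⟩
  have hpos : 0 < finrank ℝ E := finrank_pos
  have hg := norm_pos_iff.2 hg0
  rw [measureReal_def, B.volume_simplex_eq a, ENNReal.toReal_mul,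
    ENNReal.toReal_ofReal (by positivity), ← measureReal_def]
  field_simp

end Measure
end AffineBasis
end AffineGeometry

/-! ### The midpoint rule on a facet, from the symmetry under vertex exchanges. -/

section FacetMean

variable {E : Type*} [NormedAddCommGroup E] [InnerProductSpace ℝ E] [FiniteDimensional ℝ E]
  [MeasurableSpace E] [BorelSpace E]

/-- An affine map scales the Hausdorff measure on a subspace by a constant factor. -/
theorem euclideanHausdorffMeasure_image_affine (U : Submodule ℝ E) (f : E →ₗ[ℝ] E) (p q : E)
    {S : Set E} (hS : ∀ x ∈ S, x - p ∈ U) :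
    (μHE[finrank ℝ U] : Measure E) ((fun x => f (x - p) + q) '' S) =
      ENNReal.ofReal (f ∘ₗ U.subtype).normDet * (μHE[finrank ℝ U] : Measure E) S := by
  set S' : Set U := {u | (u : E) + p ∈ S} with hS'
  have h1 : S = (fun u : U => (u : E) + p) '' S' := by
    ext x
    constructor
    · intro hx
      exact ⟨⟨x - p, hS x hx⟩, by simpa [hS'] using hx, by simp⟩
    · rintro ⟨u, hu, rfl⟩
      exact hu
  have h2 : (fun x => f (x - p) + q) '' S = (fun y => y + q) '' ((f ∘ₗ U.subtype) '' S') := by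
    rw [h1, Set.image_image, Set.image_image]
    simp
  have hiso : Isometry (fun u : U => (u : E) + p) :=
    (IsometryEquiv.addRight p).isometry.comp isometry_subtype_coe
  have h3 : (μHE[finrank ℝ U] : Measure E) S = (μHE[finrank ℝ U] : Measure U) S' := by
    rw [h1, hiso.euclideanHausdorffMeasure_image]
  have hq : Isometry (fun y : E => y + q) := (IsometryEquiv.addRight q).isometry
  rw [h2, hq.euclideanHausdorffMeasure_image,
    LinearMap.euclideanHausdorffMeasure_image, h3]

variable {ι : Type*} [Fintype ι] (B : AffineBasis ι ℝ E)

namespace AffineBasis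

/-- The affine involution that exchanges two vertices of an affine basis. -/
def swapMap (b c : ι) (x : E) : E := x + (B.coord b x - B.coord c x) • (B c - B b)

theorem coord_swapMap (b c i : ι) (x : E) :
    B.coord i (B.swapMap b c x) =
      B.coord i x + (B.coord b x - B.coord c x) * (B.coord i (B c) - B.coord i (B b)) :=
  AffineMap.apply_add_smul_sub _ _ _ _ _

theorem coord_swapMap_left {b c : ι} (h : b ≠ c) (x : E) :
    B.coord b (B.swapMap b c x) = B.coord c x := by
  rw [coord_swapMap, B.coord_apply_eq, B.coord_apply_ne h]
  ring

theorem coord_swapMap_right {b c : ι} (h : b ≠ c) (x : E) :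
    B.coord c (B.swapMap b c x) = B.coord b x := by
  rw [coord_swapMap, B.coord_apply_eq, B.coord_apply_ne h.symm]
  ring

theorem coord_swapMap_of_ne {b c i : ι} (hb : i ≠ b) (hc : i ≠ c) (x : E) :
    B.coord i (B.swapMap b c x) = B.coord i x := by
  rw [coord_swapMap, B.coord_apply_ne hb, B.coord_apply_ne hc]
  ring

theorem swapMap_swapMap {b c : ι} (h : b ≠ c) (x : E) :
    B.swapMap b c (B.swapMap b c x) = x := by
  conv_lhs => rw [swapMap]
  rw [coord_swapMap_left B h, coord_swapMap_right B h, swapMap, add_assoc, ← add_smul]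
  simp

theorem swapMap_mem_facet {a b c : ι} (h : b ≠ c) (hb : b ≠ a) (hc : c ≠ a) {x : E}
    (hx : x ∈ B.facet a) : B.swapMap b c x ∈ B.facet a := by
  refine ⟨by rw [coord_swapMap_of_ne B hb.symm hc.symm, hx.1], fun i => ?_⟩
  by_cases h1 : i = b
  · subst h1
    rw [coord_swapMap_left B h]
    exact hx.2 c
  by_cases h2 : i = c
  · subst h2
    rw [coord_swapMap_right B h]
    exact hx.2 b
  rw [coord_swapMap_of_ne B h1 h2]
  exact hx.2 i

theorem continuous_swapMap (b c : ι) : Continuous (B.swapMap b c) := by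
  unfold swapMap
  have h1 := (B.coord b).continuous_real
  have h2 := (B.coord c).continuous_real
  fun_prop

theorem image_swapMap_facet {a b c : ι} (h : b ≠ c) (hb : b ≠ a) (hc : c ≠ a) :
    B.swapMap b c '' B.facet a = B.facet a := by
  refine Set.Subset.antisymm ?_ fun x hx => ?_
  · rintro _ ⟨x, hx, rfl⟩
    exact B.swapMap_mem_facet h hb hc hx
  · exact ⟨_, B.swapMap_mem_facet h hb hc hx, B.swapMap_swapMap h x⟩

/-- An affine map scales the measure of all subsets of the facet by one constant. The exchange maps
the facet onto itself, and the facet has finite nonzero measure, so the constant is 1; no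
determinant is computed. -/
theorem measure_image_swapMap [Nontrivial ι] {a b c : ι} (h : b ≠ c) (hb : b ≠ a) (hc : c ≠ a)
    {S : Set E} (hS : S ⊆ B.facet a) :
    (μHE[finrank ℝ E - 1] : Measure E) (B.swapMap b c '' S) =
      (μHE[finrank ℝ E - 1] : Measure E) S := by
  have hg0 := B.gradVec_coord_ne_zero a
  set g := (B.coord a).gradVec with hg
  set U : Submodule ℝ E := (ℝ ∙ g)ᗮ with hU
  have hrank : finrank ℝ U = finrank ℝ E - 1 := by
    have h1 := (ℝ ∙ g).finrank_add_finrank_orthogonal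
    rw [finrank_span_singleton hg0, ← hU] at h1
    omega
  set f : E →ₗ[ℝ] E := LinearMap.id +
    ((B.coord b).linear - (B.coord c).linear).smulRight (B c - B b) with hf
  have hmap : B.swapMap b c = fun x => f (x - B b) + B c := by
    ext1 x
    have h1 : (B.coord b).linear (x - B b) = B.coord b x - 1 := by
      rw [← B.coord_apply_eq b]
      exact AffineMap.linearMap_vsub _ _ _
    have h2 : (B.coord c).linear (x - B b) = B.coord c x := by
      rw [← sub_zero (B.coord c x), ← B.coord_apply_ne h.symm]
      exact AffineMap.linearMap_vsub _ _ _
    simp only [swapMap, hf, LinearMap.add_apply, LinearMap.id_apply, LinearMap.smulRight_apply,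
      LinearMap.sub_apply, h1, h2]
    module
  have hmem : ∀ x ∈ B.facet a, x - B b ∈ U := by
    intro x hx
    rw [hU, Submodule.mem_orthogonal_singleton_iff_inner_right, hg, AffineMap.inner_gradVec_sub,
      hx.1, B.coord_apply_ne hb.symm, sub_zero]
  have hscale : ∀ S ⊆ B.facet a, (μHE[finrank ℝ E - 1] : Measure E) (B.swapMap b c '' S) =
      ENNReal.ofReal (f ∘ₗ U.subtype).normDet * (μHE[finrank ℝ E - 1] : Measure E) S := by
    intro S hS
    rw [hmap, ← hrank]
    exact euclideanHausdorffMeasure_image_affine U f _ _ fun x hx => hmem x (hS hx)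
  have hone : ENNReal.ofReal (f ∘ₗ U.subtype).normDet = 1 := by
    have h1 := hscale _ subset_rfl
    rw [B.image_swapMap_facet h hb hc] at h1
    exact ((ENNReal.mul_eq_right (B.measure_facet_ne_zero a)
      (B.measure_facet_ne_top a)).1 h1.symm)
  rw [hscale S hS, hone, one_mul]

theorem measurePreserving_swapMap [Nontrivial ι] {a b c : ι} (h : b ≠ c) (hb : b ≠ a)
    (hc : c ≠ a) :
    MeasurePreserving (B.swapMap b c) ((μHE[finrank ℝ E - 1] : Measure E).restrict (B.facet a))
      ((μHE[finrank ℝ E - 1] : Measure E).restrict (B.facet a)) := by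
  have hm : Measurable (B.swapMap b c) := (B.continuous_swapMap b c).measurable
  refine ⟨hm, Measure.ext fun S hS => ?_⟩
  rw [Measure.map_apply hm hS, Measure.restrict_apply (hm hS), Measure.restrict_apply hS,
    ← B.measure_image_swapMap h hb hc (S := _ ∩ _) Set.inter_subset_right]
  congr 1
  ext x
  constructor
  · rintro ⟨y, ⟨hy, hya⟩, rfl⟩
    exact ⟨hy, B.swapMap_mem_facet h hb hc hya⟩
  · rintro ⟨hx, hxa⟩
    refine ⟨B.swapMap b c x, ⟨?_, B.swapMap_mem_facet h hb hc hxa⟩, B.swapMap_swapMap h x⟩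
    rwa [Set.mem_preimage, B.swapMap_swapMap h]

theorem integrableOn_facet [Nontrivial ι] (a : ι) {f : E → ℝ} (hf : Continuous f) :
    IntegrableOn f (B.facet a) (μHE[finrank ℝ E - 1] : Measure E) :=
  hf.continuousOn.integrableOn_of_subset_isCompact (B.isCompact_facet a)
    (B.isClosed_facet a).measurableSet subset_rfl (B.measure_facet_ne_top a)

/-- Substituting the vertex exchange turns one coordinate into the other. -/
theorem integral_facet_coord_eq [Nontrivial ι] {a b c : ι} (hb : b ≠ a) (hc : c ≠ a) :
    ∫ x in B.facet a, B.coord b x ∂μHE[finrank ℝ E - 1] =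
      ∫ x in B.facet a, B.coord c x ∂μHE[finrank ℝ E - 1] := by
  by_cases h : b = c
  · rw [h]
  have hmp := B.measurePreserving_swapMap h hb hc
  have hsm : AEStronglyMeasurable (fun x => B.coord b x)
      ((μHE[finrank ℝ E - 1] : Measure E).restrict (B.facet a)) :=
    (B.coord b).continuous_real.aestronglyMeasurable
  rw [← hmp.map_eq] at hsm
  calc ∫ x in B.facet a, B.coord b x ∂μHE[finrank ℝ E - 1]
      = ∫ x in B.facet a, B.coord b (B.swapMap b c x) ∂μHE[finrank ℝ E - 1] := by
        rw [← integral_map hmp.measurable.aemeasurable hsm, hmp.map_eq]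
    _ = _ := by simp_rw [B.coord_swapMap_left h]

/-- The integral of a barycentric coordinate over a facet. -/
theorem integral_facet_coord [Nontrivial ι] {a b : ι} (hb : b ≠ a) :
    ∫ x in B.facet a, B.coord b x ∂μHE[finrank ℝ E - 1] =
      (μHE[finrank ℝ E - 1] : Measure E).real (B.facet a) / (Fintype.card ι - 1 : ℝ) := by
  classical
  -- The coordinates sum to 1, the one of `a` vanishes on the facet, and the others share the total
  -- equally.
  have h1 : ∑ i, ∫ x in B.facet a, B.coord i x ∂μHE[finrank ℝ E - 1] =
      (μHE[finrank ℝ E - 1] : Measure E).real (B.facet a) := by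
    rw [← integral_finsetSum _ fun i _ => B.integrableOn_facet a (B.coord i).continuous_real]
    simp [B.sum_coord_apply_eq_one]
  have h2 : ∫ x in B.facet a, B.coord a x ∂μHE[finrank ℝ E - 1] = 0 := by
    rw [setIntegral_congr_fun (B.isClosed_facet a).measurableSet
      (fun x hx => hx.1 : Set.EqOn (fun x => B.coord a x) (fun _ => 0) (B.facet a))]
    simp
  rw [← Finset.add_sum_erase _ _ (Finset.mem_univ a), h2, zero_add,
    Finset.sum_congr rfl fun i hi => B.integral_facet_coord_eq (Finset.ne_of_mem_erase hi) hb,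
    Finset.sum_const, Finset.card_erase_of_mem (Finset.mem_univ a), Finset.card_univ,
    nsmul_eq_mul, Nat.cast_sub Fintype.card_pos, Nat.cast_one] at h1
  have h3 : (1 : ℝ) < Fintype.card ι := by exact_mod_cast Fintype.one_lt_card
  rw [← h1, mul_div_cancel_left₀]
  linarith

theorem affineMap_eq_sum_coord (f : E →ᵃ[ℝ] ℝ) (x : E) :
    f x = ∑ i, f (B i) * B.coord i x := by
  have h1 : f (Finset.univ.affineCombination ℝ B fun i => B.coord i x) = f x := by
    rw [B.affineCombination_coord_eq_self]
  rw [← h1, Finset.map_affineCombination _ _ _ (B.sum_coord_apply_eq_one x),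
    Finset.affineCombination_eq_linear_combination _ _ _ (B.sum_coord_apply_eq_one x)]
  simp [mul_comm]

/-- Midpoint rule on a facet. -/
theorem integral_facet_affineMap [Nontrivial ι] (a : ι) (f : E →ᵃ[ℝ] ℝ) {c : E}
    (hca : B.coord a c = 0) (hc : ∀ b ≠ a, B.coord b c = (Fintype.card ι - 1 : ℝ)⁻¹) :
    ∫ x in B.facet a, f x ∂μHE[finrank ℝ E - 1] =
      (μHE[finrank ℝ E - 1] : Measure E).real (B.facet a) * f c := by
  rw [B.affineMap_eq_sum_coord f c,
    integral_congr_ae (Filter.Eventually.of_forall (B.affineMap_eq_sum_coord f)), integral_finsetSum _ fun i _ =>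
    (B.integrableOn_facet a (B.coord i).continuous_real).const_mul _, Finset.mul_sum]
  refine Finset.sum_congr rfl fun i _ => ?_
  rw [integral_const_mul]
  by_cases hi : i = a
  · subst hi
    rw [hca, setIntegral_congr_fun (B.isClosed_facet i).measurableSet
      (fun x hx => hx.1 : Set.EqOn (fun x => B.coord i x) (fun _ => 0) (B.facet i))]
    simp
  · rw [B.integral_facet_coord hi, hc i hi]
    ring

theorem facet_eq_convexHull (a : ι) : B.facet a = convexHull ℝ (B '' {a}ᶜ) := by
  classical
  refine Set.Subset.antisymm (fun x hx => ?_) (convexHull_min ?_ ?_)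
  · have h1 := B.linear_combination_coord_eq_self x
    rw [← Finset.add_sum_erase _ _ (Finset.mem_univ a), hx.1, zero_smul, zero_add] at h1
    have h2 := B.sum_coord_apply_eq_one x
    rw [← Finset.add_sum_erase _ _ (Finset.mem_univ a), hx.1, zero_add] at h2
    rw [← h1]
    exact (convex_convexHull ℝ _).sum_mem (fun i _ => hx.2 i) h2 fun i hi =>
      subset_convexHull ℝ _ ⟨i, Finset.ne_of_mem_erase hi, rfl⟩
  · rintro _ ⟨b, hb, rfl⟩
    refine ⟨B.coord_apply_ne (Ne.symm hb), fun i => ?_⟩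
    rw [B.coord_apply]
    split_ifs <;> norm_num
  · have h1 : Convex ℝ B.simplex := by
      rw [← B.convexHull_range_eq_simplex]
      exact convex_convexHull ℝ _
    exact ((convex_singleton (0 : ℝ)).affine_preimage (B.coord a)).inter h1

end AffineBasis
end FacetMean

/-! ### Elements and their faces: mass centers, measures and outward normals. -/

namespace IPDG

variable {d : ℕ} [NeZero d]

namespace SimplicialMesh

variable {M : SimplicialMesh d}

open Module

theorem finrank_space : finrank ℝ (Space d) = d := by simp

instance (T : M.Elem) : Nontrivial T.1 := by
  rw [← Fintype.one_lt_card_iff_nontrivial, Fintype.card_coe, T.2.2]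
  have := NeZero.pos d
  omega

open Classical in
/-- The face of an element opposite to a vertex. -/
def Elem.face (T : M.Elem) (a : T.1) : M.Face :=
  ⟨T.1.erase a.1, (M.isRelLowerSet_faces T.2.1).2 (Finset.erase_subset _ _) (by
      rw [← Finset.card_pos, Finset.card_erase_of_mem a.2, T.2.2]
      exact NeZero.pos d), by
    rw [Finset.card_erase_of_mem a.2, T.2.2]
    rfl⟩

theorem Elem.mem_face (T : M.Elem) (a b : T.1) : b.1 ∈ (T.face a).1 ↔ b ≠ a := by
  classical
  change b.1 ∈ T.1.erase a.1 ↔ _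
  rw [Finset.mem_erase, Ne, Ne, Subtype.ext_iff]
  exact and_iff_left b.2

theorem Elem.face_subset (T : M.Elem) (a : T.1) : (T.face a).1 ⊆ T.1 := by
  classical exact Finset.erase_subset _ _

theorem Elem.exists_eq_face {T : M.Elem} {e : M.Face} (h : e.1 ⊆ T.1) : ∃ a, e = T.face a := by
  classical
  have h1 : (T.1 \ e.1).card = 1 := by
    rw [Finset.card_sdiff_of_subset h, T.2.2, e.2.2]
    omega
  obtain ⟨a, ha⟩ := Finset.card_eq_one.1 h1
  have haT : a ∈ T.1 \ e.1 := by simp [ha]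
  rw [Finset.mem_sdiff] at haT
  refine ⟨⟨a, haT.1⟩, Subtype.ext (Finset.eq_of_subset_of_card_le ?_ ?_)⟩
  · intro x hx
    exact Finset.mem_erase.2 ⟨fun hxa => haT.2 ((show x = a from hxa) ▸ hx), h hx⟩
  · rw [(T.face ⟨a, haT.1⟩).2.2, e.2.2]

theorem Elem.face_injective (T : M.Elem) : Function.Injective T.face := by
  intro a b h
  by_contra hab
  have h1 := (T.mem_face b a).2 hab
  rw [← h, T.mem_face] at h1
  exact h1 rfl

theorem Face.exists_elem (e : M.Face) : ∃ T : M.Elem, e.1 ⊆ T.1 := by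
  obtain ⟨T, hT, h, hc⟩ := M.pure e.1 e.2.1
  exact ⟨⟨T, hT, hc⟩, h⟩

theorem Face.exists_eq_face (e : M.Face) : ∃ (T : M.Elem) (a : T.1), e = T.face a := by
  obtain ⟨T, hT⟩ := e.exists_elem
  exact ⟨T, Elem.exists_eq_face hT⟩

theorem Elem.body_eq_simplex (T : M.Elem) : T.body = T.affineBasis.simplex := by
  rw [← T.affineBasis.convexHull_range_eq_simplex, Elem.body]
  congr 1
  exact (Subtype.range_coe (s := (T.1 : Set (Space d)))).symm

theorem Elem.coe_face (T : M.Elem) (a : T.1) :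
    ((T.face a).1 : Set (Space d)) = T.affineBasis '' {a}ᶜ := by
  ext x
  constructor
  · intro hx
    have hxT := T.face_subset a hx
    exact ⟨⟨x, hxT⟩, (T.mem_face a ⟨x, hxT⟩).1 hx, rfl⟩
  · rintro ⟨b, hb, rfl⟩
    exact (T.mem_face a b).2 hb

theorem Elem.body_face (T : M.Elem) (a : T.1) : (T.face a).body = T.affineBasis.facet a := by
  rw [AffineBasis.facet_eq_convexHull, Face.body, T.coe_face]

theorem Elem.crLocal_face (T : M.Elem) (a : T.1) :
    T.crLocal (T.face a) = AffineMap.const ℝ (Space d) 1 - (d : ℝ) • T.affineBasis.coord a := by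
  classical
  rw [Elem.crLocal]
  congr 2
  rw [Finset.sum_eq_single a]
  · rw [if_neg]
    rw [T.mem_face]
    simp
  · intro b _ hb
    rw [if_pos ((T.mem_face a b).2 hb)]
  · simp

theorem natCast_dim_ne_zero : (d : ℝ) ≠ 0 := Nat.cast_ne_zero.2 (NeZero.ne d)

theorem Elem.crLocal_face_apply (T : M.Elem) (a : T.1) (x : Space d) :
    T.crLocal (T.face a) x = 1 - d * T.affineBasis.coord a x := by
  rw [T.crLocal_face]
  simp

/-- Since `φ_{e,T} = 1 - d λ_a`, the known values of `φ_{e,T}` at mass centers determine the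
barycentric coordinates of these centers. -/
theorem Elem.coord_center_self (T : M.Elem) (a : T.1) :
    T.affineBasis.coord a (T.face a).center = 0 := by
  have h := T.crLocal_center (T.face a) (T.face a) (NeZero.ne d) (T.face_subset a)
    (T.face_subset a)
  rw [T.crLocal_face_apply, if_pos rfl] at h
  simpa [NeZero.ne d] using h

theorem Elem.coord_center_of_ne (T : M.Elem) {a b : T.1} (hab : b ≠ a) :
    T.affineBasis.coord b (T.face a).center = (d : ℝ)⁻¹ := by
  have h := T.crLocal_center (T.face b) (T.face a) (NeZero.ne d) (T.face_subset b)
    (T.face_subset a)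
  rw [T.crLocal_face_apply, if_neg (fun h => hab (T.face_injective h).symm)] at h
  have := natCast_dim_ne_zero (d := d)
  field_simp
  linarith

theorem Elem.size_face (T : M.Elem) (a : T.1) :
    volume.real T.body * (d * ‖(T.affineBasis.coord a).gradVec‖) = (T.face a).size := by
  have h := T.affineBasis.volume_real_simplex_mul a
  rw [finrank_space] at h
  rw [Face.size, T.body_face, T.body_eq_simplex, h]

theorem Face.size_pos (e : M.Face) : 0 < e.size := by
  obtain ⟨T, a, rfl⟩ := e.exists_eq_face
  rw [Face.size, T.body_face]
  have h1 := T.affineBasis.measure_facet_ne_zero a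
  have h2 := T.affineBasis.measure_facet_ne_top a
  rw [finrank_space] at h1 h2
  exact ENNReal.toReal_pos h1 h2

/-- Midpoint rule on a face. -/
theorem Face.integral_affineMap (e : M.Face) (f : Space d →ᵃ[ℝ] ℝ) :
    e.integral f = e.size * f e.center := by
  obtain ⟨T, a, rfl⟩ := e.exists_eq_face
  have hcard : (Fintype.card T.1 - 1 : ℝ) = d := by
    rw [Fintype.card_coe, T.2.2]
    simp
  have h := T.affineBasis.integral_facet_affineMap a f (T.coord_center_self a)
    fun b hb => by rw [T.coord_center_of_ne hb, hcard]
  rw [finrank_space] at h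
  rw [Face.integral, Face.size, T.body_face, h]

theorem Face.P0_affineMap (e : M.Face) (f : Space d →ᵃ[ℝ] ℝ) : e.P0 f = f e.center := by
  have h := e.integral_affineMap f
  have hs := e.size_pos.ne'
  rw [Face.integral] at h
  rw [Face.P0, setAverage_eq, h]
  change e.size⁻¹ • (e.size * f e.center) = _
  rw [smul_eq_mul, inv_mul_cancel_left₀ hs]

theorem Face.P0_affineMap_smul {F : Type*} [NormedAddCommGroup F] [NormedSpace ℝ F] [CompleteSpace F]
    (e : M.Face) (f : Space d →ᵃ[ℝ] ℝ) (n : F) : e.P0 (fun x => f x • n) = f e.center • n := by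
  rw [← e.P0_affineMap f, Face.P0, Face.P0, setAverage_eq, setAverage_eq, integral_smul_const,
    smul_assoc]

theorem Elem.coord_centroid (T : M.Elem) (a : T.1) :
    T.affineBasis.coord a (T.1.centroid ℝ id) = ((d : ℝ) + 1)⁻¹ := by
  have h := T.affineBasis.coord_apply_centroid (s := Finset.univ) (Finset.mem_univ a)
  rw [Finset.card_univ, Fintype.card_coe, T.2.2] at h
  rw [← Finset.centroid_univ]
  push_cast at h
  exact h

/-- `λ_a` is constant on the face, so its gradient is orthogonal to it; the `d` affinely independent
vertices of the face span `d - 1` directions, leaving only a line. -/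
theorem Elem.orthogonal_vectorSpan_face (T : M.Elem) (a : T.1) :
    (vectorSpan ℝ ((T.face a).1 : Set (Space d)))ᗮ = ℝ ∙ (T.affineBasis.coord a).gradVec := by
  have hg := T.affineBasis.gradVec_coord_ne_zero a
  have hle : (ℝ ∙ (T.affineBasis.coord a).gradVec) ≤
      (vectorSpan ℝ ((T.face a).1 : Set (Space d)))ᗮ := by
    rw [Submodule.span_singleton_le_iff_mem, Submodule.mem_orthogonal']
    intro u hu
    rw [vectorSpan] at hu
    induction hu using Submodule.span_induction with
    | mem x hx =>
      obtain ⟨y, hy, z, hz, rfl⟩ := hx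
      rw [T.coe_face] at hy hz
      obtain ⟨b, hb, rfl⟩ := hy
      obtain ⟨c, hc, rfl⟩ := hz
      have h : ⟪(T.affineBasis.coord a).gradVec, T.affineBasis b - T.affineBasis c⟫_ℝ = 0 := by
        rw [AffineMap.inner_gradVec_sub, T.affineBasis.coord_apply_ne (Ne.symm hb),
          T.affineBasis.coord_apply_ne (Ne.symm hc), sub_zero]
      exact h
    | zero => simp
    | add x y _ _ hx hy => rw [inner_add_right, hx, hy, add_zero]
    | smul c x _ hx => rw [inner_smul_right, hx, mul_zero]
  refine (Submodule.eq_of_le_of_finrank_eq hle ?_).symm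
  rw [finrank_span_singleton hg]
  have h1 := (vectorSpan ℝ ((T.face a).1 : Set (Space d))).finrank_add_finrank_orthogonal
  have h2 : finrank ℝ (vectorSpan ℝ ((T.face a).1 : Set (Space d))) = d - 1 := by
    have h3 := (M.indep (T.face a).2.1).finrank_vectorSpan (n := d - 1) (by
      rw [Fintype.card_coe, (T.face a).2.2]
      have := NeZero.pos d
      omega)
    rwa [Subtype.range_coe_subtype] at h3
  rw [h2, finrank_space] at h1
  have := NeZero.pos d
  omega

/-- From the barycenter of `T` to that of the face, `λ_a` falls from `1 / (d + 1)` to 0, which fixes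
the sign. -/
theorem Elem.normal_face (T : M.Elem) (a : T.1) :
    T.normal (T.face a) =
      -(‖(T.affineBasis.coord a).gradVec‖⁻¹ • (T.affineBasis.coord a).gradVec) := by
  have hg := T.affineBasis.gradVec_coord_ne_zero a
  set g := (T.affineBasis.coord a).gradVec with hgdef
  have hgn := norm_pos_iff.2 hg
  have hd : (0 : ℝ) < (d : ℝ) + 1 := by positivity
  have hν : (vectorSpan ℝ ((T.face a).1 : Set (Space d)))ᗮ.starProjection
      ((T.face a).center - T.1.centroid ℝ id) = (-(((d : ℝ) + 1)⁻¹ / ‖g‖ ^ 2)) • g := by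
    simp only [T.orthogonal_vectorSpan_face a, ← hgdef]
    rw [Submodule.starProjection_singleton, hgdef, AffineMap.inner_gradVec_sub,
      T.coord_center_self, T.coord_centroid]
    congr 1
    simp
    ring
  rw [Elem.normal]
  simp only [hν]
  rw [norm_smul, norm_neg, Real.norm_of_nonneg (by positivity), smul_smul, ← neg_smul]
  congr 1
  field_simp

theorem Elem.norm_normal {T : M.Elem} {e : M.Face} (h : e.1 ⊆ T.1) : ‖T.normal e‖ = 1 := by
  obtain ⟨a, rfl⟩ := Elem.exists_eq_face h
  rw [T.normal_face, norm_neg, norm_smul, norm_inv, norm_norm]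
  exact inv_mul_cancel₀ (norm_ne_zero_iff.2 (T.affineBasis.gradVec_coord_ne_zero a))

/-- The divergence theorem for a local Crouzeix-Raviart basis function. -/
theorem Elem.volume_smul_gradVec_crLocal {T : M.Elem} {e : M.Face} (h : e.1 ⊆ T.1) :
    volume.real T.body • (T.crLocal e).gradVec = e.size • T.normal e := by
  obtain ⟨a, rfl⟩ := Elem.exists_eq_face h
  have hg := norm_ne_zero_iff.2 (T.affineBasis.gradVec_coord_ne_zero a)
  have h1 : (T.crLocal (T.face a)).gradVec = (-(d : ℝ)) • (T.affineBasis.coord a).gradVec := by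
    refine ext_inner_right ℝ fun y => ?_
    rw [T.crLocal_face, AffineMap.inner_gradVec, inner_smul_left, AffineMap.inner_gradVec]
    simp
  rw [h1, T.normal_face, ← T.size_face, smul_smul, ← neg_smul, smul_smul]
  congr 1
  field_simp

/-! ### Neighbouring elements and the divergence theorem. -/

theorem Elem.inter_eq_face {T T' : M.Elem} (hne : T ≠ T') {a : T.1}
    (h : (T.face a).1 ⊆ T'.1) :
    (T.1 : Set (Space d)) ∩ T'.1 = ((T.face a).1 : Set (Space d)) := by
  refine Set.Subset.antisymm ?_ fun x hx => ⟨T.face_subset a hx, h hx⟩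
  rintro x ⟨hx, hx'⟩
  refine (T.mem_face a ⟨x, hx⟩).2 fun hxa => hne (Subtype.ext ?_)
  refine Finset.eq_of_subset_of_card_le (fun y hy => ?_) (by rw [T.2.2, T'.2.2])
  by_cases hya : (⟨y, hy⟩ : T.1) = a
  · rw [← hxa] at hya
    have : y = x := congrArg Subtype.val hya
    rw [this]
    exact hx'
  · exact h ((T.mem_face a ⟨y, hy⟩).2 hya)

/-- Two elements that share a face lie on opposite sides of it. -/
theorem Elem.coord_opposite_neg {T T' : M.Elem} (hne : T ≠ T') {a : T.1} {a' : T'.1}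
    (h : T.face a = T'.face a') : T.affineBasis.coord a a'.1 < 0 := by
  -- Otherwise a short move from the center of the common face towards `a'` stays in `T`, since the
  -- other coordinates are `1 / d` at the center. It also stays in `T'` but leaves the face,
  -- contradicting the intersection axiom.
  by_contra! hcon
  set c := (T.face a).center with hc
  have hd : (0 : ℝ) < (d : ℝ)⁻¹ := by
    have := NeZero.pos d
    positivity
  have h1 : ∀ b : T.1, ∀ᶠ t : ℝ in nhdsWithin 0 (Set.Ioi 0),
      0 ≤ T.affineBasis.coord b (c + t • (a'.1 - c)) := by
    intro b
    by_cases hb : b = a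
    · subst hb
      filter_upwards [self_mem_nhdsWithin] with t ht
      rw [AffineMap.apply_add_smul_sub, hc, T.coord_center_self]
      have : (0 : ℝ) < t := ht
      simp only [zero_add, sub_zero]
      positivity
    · have hcont : Continuous fun t : ℝ => T.affineBasis.coord b (c + t • (a'.1 - c)) :=
        (T.affineBasis.coord b).continuous_real.comp (by fun_prop)
      have hpos : 0 < T.affineBasis.coord b (c + (0 : ℝ) • (a'.1 - c)) := by
        rw [zero_smul, add_zero, hc, T.coord_center_of_ne hb]
        exact hd
      exact ((hcont.tendsto 0).eventually_const_lt hpos).filter_mono nhdsWithin_le_nhds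
        |>.mono fun t ht => ht.le
  have h2 : ∀ᶠ t : ℝ in nhdsWithin 0 (Set.Ioi 0), t < 1 :=
    (eventually_lt_nhds one_pos).filter_mono nhdsWithin_le_nhds
  obtain ⟨t, ht, ht1, ht0⟩ :=
    ((Filter.eventually_all.2 h1).and (h2.and self_mem_nhdsWithin)).exists
  have ht0' : (0 : ℝ) < t := ht0
  have hT : c + t • (a'.1 - c) ∈ T.body := by
    rw [T.body_eq_simplex]
    exact ht
  have hcT' : T'.affineBasis.coord a' (c + t • (a'.1 - c)) = t := by
    rw [AffineMap.apply_add_smul_sub, hc, h, T'.coord_center_self]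
    have : T'.affineBasis.coord a' a'.1 = 1 := T'.affineBasis.coord_apply_eq a'
    rw [this]
    ring
  have hT' : c + t • (a'.1 - c) ∈ T'.body := by
    rw [T'.body_eq_simplex]
    intro b
    by_cases hb : b = a'
    · rw [hb, hcT']
      exact ht0'.le
    · have h3 : T'.affineBasis.coord b a'.1 = 0 := T'.affineBasis.coord_apply_ne hb
      rw [AffineMap.apply_add_smul_sub, hc, h, T'.coord_center_of_ne hb, h3]
      nlinarith
  have h4 := M.inter_subset_convexHull T.2.1 T'.2.1 ⟨hT, hT'⟩
  rw [Elem.inter_eq_face hne (a := a) (h ▸ T'.face_subset a'), h] at h4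
  have h5 : c + t • (a'.1 - c) ∈ (T'.face a').body := h4
  rw [T'.body_face] at h5
  rw [h5.1] at hcT'
  exact ht0'.ne hcT'

/-- Both coordinates vanish on the common face, hence at every vertex of `T'` except `a'`, so they
are proportional. -/
theorem Elem.coord_eq_mul_coord {T T' : M.Elem} {a : T.1} {a' : T'.1}
    (h : T.face a = T'.face a') (x : Space d) :
    T.affineBasis.coord a x = T.affineBasis.coord a a'.1 * T'.affineBasis.coord a' x := by
  rw [T'.affineBasis.affineMap_eq_sum_coord (T.affineBasis.coord a) x,
    Finset.sum_eq_single a']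
  · rfl
  · intro b _ hb
    have h1 : b.1 ∈ (T.face a).1 := h ▸ (T'.mem_face a' b).2 hb
    have h2 : T.affineBasis.coord a (T'.affineBasis b) = 0 :=
      T.affineBasis.coord_apply_ne (j := ⟨b.1, T.face_subset a h1⟩)
        (((T.mem_face a ⟨b.1, T.face_subset a h1⟩).1 h1).symm)
    rw [h2, zero_mul]
  · simp

/-- The outward unit normals of two elements on a common face are opposite. -/
theorem Elem.normal_eq_neg {T T' : M.Elem} (hne : T ≠ T') {e : M.Face} (h : e.1 ⊆ T.1)
    (h' : e.1 ⊆ T'.1) : T'.normal e = -T.normal e := by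
  obtain ⟨a, rfl⟩ := Elem.exists_eq_face h
  obtain ⟨a', ha'⟩ := Elem.exists_eq_face h'
  have hneg := Elem.coord_opposite_neg hne ha'
  have h1 : T.affineBasis.coord a = T.affineBasis.coord a a'.1 • T'.affineBasis.coord a' := by
    ext x
    exact Elem.coord_eq_mul_coord ha' x
  rw [T.normal_face, ha', T'.normal_face, h1, AffineMap.gradVec_smul, norm_smul,
    Real.norm_of_nonpos hneg.le, neg_neg, smul_smul, ← neg_smul]
  congr 1
  have := hneg.ne
  field_simp

/-- No face is shared by three elements. -/
theorem Elem.eq_or_eq_of_subset {T T' T'' : M.Elem} (hne : T ≠ T') {e : M.Face} (h : e.1 ⊆ T.1)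
    (h' : e.1 ⊆ T'.1) (h'' : e.1 ⊆ T''.1) : T'' = T ∨ T'' = T' := by
  by_contra! hcon
  -- Three pairwise opposite unit normals would make a normal equal to its own negative.
  have h1 := Elem.normal_eq_neg hne h h'
  have h2 := Elem.normal_eq_neg hcon.1 h'' h
  have h3 := Elem.normal_eq_neg hcon.2 h'' h'
  have h4 : T.normal e = 0 := by
    rw [h3, ← h2] at h1
    have h6 := eq_neg_iff_add_eq_zero.1 h1
    rw [← two_smul ℝ] at h6
    simpa using h6
  have h5 := Elem.norm_normal h
  rw [h4, norm_zero] at h5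
  exact zero_ne_one h5

/-- An affine function is determined by its values at the mass centers of the faces of a simplex. -/
theorem Elem.eq_sum_crLocal (T : M.Elem) (f : Space d →ᵃ[ℝ] ℝ) :
    f = ∑ a : T.1, f (T.face a).center • T.crLocal (T.face a) := by
  have hd := natCast_dim_ne_zero (d := d)
  have hval : ∀ a : T.1, f (T.face a).center = (d : ℝ)⁻¹ * (∑ b : T.1, f b.1 - f a.1) := by
    intro a
    rw [T.affineBasis.affineMap_eq_sum_coord f, ← Finset.add_sum_erase _ _ (Finset.mem_univ a),
      T.coord_center_self, mul_zero, zero_add, ← Finset.add_sum_erase (a := a) _ (fun b : T.1 => f b.1)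
      (Finset.mem_univ a), add_sub_cancel_left, Finset.mul_sum]
    refine Finset.sum_congr rfl fun b hb => ?_
    rw [T.coord_center_of_ne (Finset.ne_of_mem_erase hb), mul_comm]
    rfl
  -- Each vertex lies on `d` of the `d + 1` faces, which compensates the factor `1 / d`.
  have hsum : ∑ a : T.1, f (T.face a).center = ∑ b : T.1, f b.1 := by
    simp_rw [hval]
    rw [← Finset.mul_sum, Finset.sum_sub_distrib, Finset.sum_const, Finset.card_univ,
      Fintype.card_coe, T.2.2, nsmul_eq_mul]
    push_cast
    field_simp
    ring
  have happ : ∀ (s : Finset T.1) (x : Space d),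
      (∑ a ∈ s, f (T.face a).center • T.crLocal (T.face a)) x =
        ∑ a ∈ s, f (T.face a).center * T.crLocal (T.face a) x := by
    classical
    intro s x
    induction s using Finset.induction_on with
    | empty => simp
    | insert b s hb ih =>
      rw [Finset.sum_insert hb, Finset.sum_insert hb, AffineMap.coe_add, Pi.add_apply, ih]
      rfl
  ext x
  rw [happ]
  simp_rw [T.crLocal_face_apply, mul_sub, mul_one, Finset.sum_sub_distrib, hsum, hval]
  have h1 : ∀ a : T.1, (d : ℝ)⁻¹ * (∑ b : T.1, f b.1 - f a.1) * (d * T.affineBasis.coord a x) =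
      (∑ b : T.1, f b.1) * T.affineBasis.coord a x - f a.1 * T.affineBasis.coord a x := by
    intro a
    field_simp
  simp_rw [h1]
  rw [Finset.sum_sub_distrib, ← Finset.mul_sum, T.affineBasis.sum_coord_apply_eq_one, mul_one,
    sub_sub_cancel]
  exact T.affineBasis.affineMap_eq_sum_coord f x

/-- The divergence theorem for affine functions on an element, with constant vector fields. -/
theorem Elem.volume_mul_inner_gradVec (T : M.Elem) (q : Space d) (f : Space d →ᵃ[ℝ] ℝ) :
    volume.real T.body * ⟪q, f.gradVec⟫_ℝ =
      ∑ a : T.1, (T.face a).size * f (T.face a).center * ⟪q, T.normal (T.face a)⟫_ℝ := by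
  conv_lhs => rw [T.eq_sum_crLocal f]
  rw [AffineMap.gradVec_sum, inner_sum, Finset.mul_sum]
  refine Finset.sum_congr rfl fun a _ => ?_
  have h := congrArg (fun y => ⟪q, y⟫_ℝ) (Elem.volume_smul_gradVec_crLocal (T.face_subset a))
  simp only [inner_smul_right] at h
  rw [AffineMap.gradVec_smul, inner_smul_right, mul_left_comm, h]
  ring

open Classical in
theorem Elem.sum_face (T : M.Elem) (F : M.Face → ℝ) :
    ∑ a : T.1, F (T.face a) = ∑ e : M.Face, if e.1 ⊆ T.1 then F e else 0 := by
  rw [← Finset.sum_filter]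
  refine Finset.sum_bij (fun a _ => T.face a) ?_ ?_ ?_ ?_
  · intro a _
    exact Finset.mem_filter.2 ⟨Finset.mem_univ _, T.face_subset a⟩
  · intro a _ b _ h
    exact T.face_injective h
  · intro e he
    obtain ⟨a, rfl⟩ := Elem.exists_eq_face (Finset.mem_filter.1 he).2
    exact ⟨a, Finset.mem_univ _, rfl⟩
  · intro a _
    rfl

/-! ### Reordering sums over elements into sums over faces. -/

namespace Labelling

variable (L : M.Labelling)

theorem subset_iff_interior (e : M.InteriorFace) (T : M.Elem) :
    e.1.1 ⊆ T.1 ↔ T = L.plus e.1 ∨ T = L.minus e := by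
  constructor
  · exact Elem.eq_or_eq_of_subset (L.plus_ne_minus e) (L.subset_plus _) (L.subset_minus _)
  · rintro (rfl | rfl)
    · exact L.subset_plus _
    · exact L.subset_minus _

theorem subset_iff_boundary {e : M.Face} (he : ¬ M.IsInterior e) (T : M.Elem) :
    e.1 ⊆ T.1 ↔ T = L.plus e := by
  constructor
  · intro h
    by_contra hne
    exact he ⟨T, L.plus e, hne, h, L.subset_plus e⟩
  · rintro rfl
    exact L.subset_plus e

open Classical in
/-- Summation over all pairs of an element and one of its faces. -/
theorem sum_elem_face (F : M.Elem → M.Face → ℝ) :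
    ∑ T : M.Elem, ∑ a : T.1, F T (T.face a) =
      ∑ e : M.Face, if h : M.IsInterior e then F (L.plus e) e + F (L.minus ⟨e, h⟩) e
        else F (L.plus e) e := by
  simp_rw [fun T : M.Elem => T.sum_face (F T)]
  rw [Finset.sum_comm]
  refine Finset.sum_congr rfl fun e _ => ?_
  split_ifs with h
  · simp_rw [fun T => L.subset_iff_interior ⟨e, h⟩ T]
    rw [← Finset.sum_filter, Finset.filter_or, Finset.sum_union, Finset.filter_eq',
      Finset.filter_eq']
    · simp
    · rw [Finset.filter_eq', Finset.filter_eq']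
      simpa using L.plus_ne_minus ⟨e, h⟩
  · simp_rw [L.subset_iff_boundary h]
    simp

end Labelling

/-! ### The bilinear form in midpoint values, its one-sided orthogonality and symmetry. -/

namespace Labelling

variable (L : M.Labelling)

open Classical in
/-- The scalar jump `v⁺ - v⁻` (or `v` on a boundary face), as an affine function. -/
def jumpAffine (v : M.DG) (e : M.Face) : Space d →ᵃ[ℝ] ℝ :=
  if h : M.IsInterior e then v (L.plus e) - v (L.minus ⟨e, h⟩) else v (L.plus e)

theorem normal_minus (e : M.InteriorFace) :
    (L.minus e).normal e.1 = -(L.plus e.1).normal e.1 :=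
  Elem.normal_eq_neg (L.plus_ne_minus e) (L.subset_plus _) (L.subset_minus _)

/-- As the two normals are opposite, the vector jump is an affine scalar times one fixed normal, so
the midpoint rule applies to every face term. -/
theorem jump_eq (v : M.DG) (e : M.Face) (x : Space d) :
    L.jump v e x = L.jumpAffine v e x • (L.plus e).normal e := by
  unfold jump jumpAffine
  split_ifs with h
  · rw [L.normal_minus ⟨e, h⟩, smul_neg, ← sub_eq_add_neg, ← sub_smul]
    rfl
  · rfl

/-- The mean value of the scalar jump. -/
def jumpMean (v : M.DG) (e : M.Face) : ℝ := L.jumpAffine v e e.center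

theorem jumpMean_interior (v : M.DG) (e : M.InteriorFace) :
    L.jumpMean v e.1 = v (L.plus e.1) e.1.center - v (L.minus e) e.1.center := by
  rw [jumpMean, jumpAffine, dif_pos e.2]
  rfl

theorem jumpMean_boundary (v : M.DG) {e : M.Face} (h : ¬ M.IsInterior e) :
    L.jumpMean v e = v (L.plus e) e.center := by
  rw [jumpMean, jumpAffine, dif_neg h]

/-- The mean value of the average `{v}_{1 - β}`. -/
def avgMean (κ : M.Elem → ℝ) (v : M.DG) (e : M.InteriorFace) : ℝ :=
  (1 - L.beta κ e) * v (L.plus e.1) e.1.center + L.beta κ e * v (L.minus e) e.1.center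

open Classical in
/-- The normal component of the averaged flux `{κ ∇ v}_β`. -/
def fluxMean (κ : M.Elem → ℝ) (v : M.DG) (e : M.Face) : ℝ :=
  if h : M.IsInterior e then
    L.beta κ ⟨e, h⟩ * (κ (L.plus e) * ⟪(v (L.plus e)).gradVec, (L.plus e).normal e⟫_ℝ) +
      (1 - L.beta κ ⟨e, h⟩) *
        (κ (L.minus ⟨e, h⟩) * ⟪(v (L.minus ⟨e, h⟩)).gradVec, (L.plus e).normal e⟫_ℝ)
  else κ (L.plus e) * ⟪(v (L.plus e)).gradVec, (L.plus e).normal e⟫_ℝ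

theorem inner_avg_flux (κ : M.Elem → ℝ) (v : M.DG) (e : M.Face) (x : Space d) :
    ⟪L.avg (L.beta κ) (flux κ v) e x, (L.plus e).normal e⟫_ℝ = L.fluxMean κ v e := by
  unfold avg fluxMean flux
  split_ifs with h
  · simp only [AffineMap.gradient_eq_gradVec, inner_add_left, inner_smul_left, RCLike.conj_to_real]
  · simp only [AffineMap.gradient_eq_gradVec, inner_smul_left, RCLike.conj_to_real]

theorem inner_normal_self (e : M.Face) :
    ⟪(L.plus e).normal e, (L.plus e).normal e⟫_ℝ = 1 := by
  rw [real_inner_self_eq_norm_sq, Elem.norm_normal (L.subset_plus e), one_pow]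

theorem integral_jumpAffine_mul (v : M.DG) (e : M.Face) (c : ℝ) :
    e.integral (fun x => c * L.jumpAffine v e x) = e.size * (c * L.jumpMean v e) :=
  e.integral_affineMap (c • L.jumpAffine v e)

/-- The bilinear form in terms of the values at the mass centers of the faces. -/
theorem A0_eq (κ : M.Elem → ℝ) (α θ : ℝ) (v w : M.DG) :
    L.A0 κ α θ v w =
      ∑ T : M.Elem, κ T * (volume.real T.body * ⟪(v T).gradVec, (w T).gradVec⟫_ℝ)
      - ∑ e : M.Face, e.size * (L.fluxMean κ v e * L.jumpMean w e)
      + θ * ∑ e : M.Face, e.size * (L.fluxMean κ w e * L.jumpMean v e)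
      + ∑ e : M.Face, α * L.kappaFace κ e * L.jumpMean v e * L.jumpMean w e := by
  rw [A0]
  congr 1
  · congr 1
    · congr 1
      · refine Finset.sum_congr rfl fun T _ => ?_
        simp only [flux, AffineMap.gradient_eq_gradVec, inner_smul_left, RCLike.conj_to_real]
        rw [setIntegral_const, smul_eq_mul]
        ring
      · refine Finset.sum_congr rfl fun e _ => ?_
        rw [← L.integral_jumpAffine_mul]
        congr 1
        ext x
        rw [L.jump_eq, inner_smul_right, L.inner_avg_flux, mul_comm]
    · congr 1
      refine Finset.sum_congr rfl fun e _ => ?_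
      rw [← L.integral_jumpAffine_mul]
      congr 1
      ext x
      rw [L.jump_eq, real_inner_comm, inner_smul_right, L.inner_avg_flux, mul_comm]
  · refine Finset.sum_congr rfl fun e _ => ?_
    have h1 : e.P0 (L.jump v e) = L.jumpMean v e • (L.plus e).normal e := by
      rw [jumpMean, ← e.P0_affineMap_smul]
      congr 1
      ext1 x
      exact L.jump_eq v e x
    have h2 : (fun x => ⟪(α * (e.size)⁻¹ * L.kappaFace κ e) • e.P0 (L.jump v e), L.jump w e x⟫_ℝ) =
        fun x => (α * (e.size)⁻¹ * L.kappaFace κ e * L.jumpMean v e) * L.jumpAffine w e x := by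
      ext x
      rw [h1, L.jump_eq, inner_smul_left, inner_smul_left, inner_smul_right, L.inner_normal_self]
      simp only [RCLike.conj_to_real]
      ring
    -- Integrating over `e` contributes a factor `|e|` that cancels `h_e⁻¹`.
    rw [h2, L.integral_jumpAffine_mul]
    have := e.size_pos.ne'
    field_simp

theorem mem_VCR_iff (v : M.DG) : v ∈ L.VCR ↔ ∀ e, L.jumpMean v e = 0 := by
  refine forall_congr' fun e => ?_
  have h : (fun x => ⟪L.jump v e x, (L.plus e).normal e⟫_ℝ) = L.jumpAffine v e := by
    ext x
    rw [L.jump_eq, inner_smul_left, L.inner_normal_self]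
    simp
  rw [h, e.P0_affineMap, jumpMean]

theorem mem_Zbeta_iff (κ : M.Elem → ℝ) (z : M.DG) :
    z ∈ L.Zbeta κ ↔ ∀ e, L.avgMean κ z e = 0 := by
  refine forall_congr' fun e => ?_
  have h : L.avg (fun e => 1 - L.beta κ e) (fun T x => z T x) e.1 =
      ((1 - L.beta κ e) • z (L.plus e.1) + L.beta κ e • z (L.minus e) : Space d →ᵃ[ℝ] ℝ) := by
    ext x
    rw [avg, dif_pos e.2]
    change _ • _ + (1 - (1 - L.beta κ e)) • _ = _
    rw [sub_sub_cancel]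
    rfl
  rw [h, e.1.P0_affineMap]
  rfl

theorem A0_VCR_Zbeta (κ : M.Elem → ℝ) (α θ : ℝ) {v z : M.DG} (hv : v ∈ L.VCR)
    (hz : z ∈ L.Zbeta κ) : L.A0 κ α θ v z = 0 := by
  rw [L.mem_VCR_iff] at hv
  rw [L.mem_Zbeta_iff] at hz
  have h1 : ∀ T : M.Elem, κ T * (volume.real T.body * ⟪(v T).gradVec, (z T).gradVec⟫_ℝ) =
      ∑ a : T.1, κ T * ((T.face a).size * z T (T.face a).center *
        ⟪(v T).gradVec, T.normal (T.face a)⟫_ℝ) := fun T => by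
    rw [T.volume_mul_inner_gradVec, Finset.mul_sum]
  rw [A0_eq, Finset.sum_congr rfl fun T _ => h1 T,
    L.sum_elem_face fun T e => κ T * (e.size * z T e.center * ⟪(v T).gradVec, T.normal e⟫_ℝ)]
  simp only [hv, mul_zero, zero_mul, Finset.sum_const_zero, add_zero]
  rw [sub_eq_zero]
  refine Finset.sum_congr rfl fun e _ => ?_
  split_ifs with h
  · have hz' : (1 - L.beta κ ⟨e, h⟩) * z (L.plus e) e.center +
        L.beta κ ⟨e, h⟩ * z (L.minus ⟨e, h⟩) e.center = 0 := hz ⟨e, h⟩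
    rw [L.jumpMean_interior z ⟨e, h⟩, fluxMean, dif_pos h, L.normal_minus ⟨e, h⟩, inner_neg_right]
    -- The multiplier of the vanishing average is `|e|` times the jump of the normal flux of `v`.
    linear_combination e.size * (κ (L.plus e) * ⟪(v (L.plus e)).gradVec, (L.plus e).normal e⟫_ℝ -
      κ (L.minus ⟨e, h⟩) * ⟪(v (L.minus ⟨e, h⟩)).gradVec, (L.plus e).normal e⟫_ℝ) * hz'
  · rw [L.jumpMean_boundary z h, fluxMean, dif_neg h]
    ring

theorem A0_symm (κ : M.Elem → ℝ) (α : ℝ) (v w : M.DG) :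
    L.A0 κ α (-1) v w = L.A0 κ α (-1) w v := by
  rw [A0_eq, A0_eq]
  have h1 : ∀ T : M.Elem, ⟪(v T).gradVec, (w T).gradVec⟫_ℝ = ⟪(w T).gradVec, (v T).gradVec⟫_ℝ :=
    fun T => real_inner_comm _ _
  have h2 : ∀ e : M.Face, α * L.kappaFace κ e * L.jumpMean v e * L.jumpMean w e =
      α * L.kappaFace κ e * L.jumpMean w e * L.jumpMean v e := fun e => by ring
  simp_rw [h1, h2]
  ring

/-! ### Jump and average coordinates, the dual basis and the decomposition. -/

/-- The coordinates on `V_h^DG`: the mean values of the jumps and of the averages. -/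
def coordMap (κ : M.Elem → ℝ) : M.DG →ₗ[ℝ] (M.Face ⊕ M.InteriorFace → ℝ) where
  toFun v := Sum.elim (L.jumpMean v) (L.avgMean κ v)
  map_add' v w := by
    ext (e | e)
    · change L.jumpMean (v + w) e = L.jumpMean v e + L.jumpMean w e
      by_cases h : M.IsInterior e
      · simp only [L.jumpMean_interior _ ⟨e, h⟩, Pi.add_apply, AffineMap.coe_add]
        ring
      · simp only [L.jumpMean_boundary _ h, Pi.add_apply, AffineMap.coe_add]
    · change L.avgMean κ (v + w) e = L.avgMean κ v e + L.avgMean κ w e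
      simp only [avgMean, Pi.add_apply, AffineMap.coe_add]
      ring
  map_smul' c v := by
    ext (e | e)
    · change L.jumpMean (c • v) e = c * L.jumpMean v e
      by_cases h : M.IsInterior e
      · simp only [L.jumpMean_interior _ ⟨e, h⟩, Pi.smul_apply, AffineMap.coe_smul, smul_eq_mul]
        ring
      · simp only [L.jumpMean_boundary _ h, Pi.smul_apply, AffineMap.coe_smul, smul_eq_mul]
    · change L.avgMean κ (c • v) e = c * L.avgMean κ v e
      simp only [avgMean, Pi.smul_apply, AffineMap.coe_smul, smul_eq_mul]
      ring

theorem coordMap_inl (κ : M.Elem → ℝ) (v : M.DG) (e : M.Face) :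
    L.coordMap κ v (Sum.inl e) = L.jumpMean v e := rfl

theorem coordMap_inr (κ : M.Elem → ℝ) (v : M.DG) (e : M.InteriorFace) :
    L.coordMap κ v (Sum.inr e) = L.avgMean κ v e := rfl

/-- On an interior face `v⁺ = avg + β jump` and `v⁻ = avg - (1 - β) jump` at the center, a system of
determinant 1 for every `β`. The center values on all faces determine `v`. -/
theorem coordMap_injective (κ : M.Elem → ℝ) : Function.Injective (L.coordMap κ) := by
  rw [← LinearMap.ker_eq_bot, LinearMap.ker_eq_bot']
  intro v hv
  have hj : ∀ e, L.jumpMean v e = 0 := fun e => congrFun hv (Sum.inl e)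
  have ha : ∀ e, L.avgMean κ v e = 0 := fun e => congrFun hv (Sum.inr e)
  have hval : ∀ (T : M.Elem) (e : M.Face), e.1 ⊆ T.1 → v T e.center = 0 := by
    intro T e hT
    have h1 := hj e
    by_cases h : M.IsInterior e
    · have h2 : (1 - L.beta κ ⟨e, h⟩) * v (L.plus e) e.center +
          L.beta κ ⟨e, h⟩ * v (L.minus ⟨e, h⟩) e.center = 0 := ha ⟨e, h⟩
      rw [L.jumpMean_interior v ⟨e, h⟩] at h1
      rcases (L.subset_iff_interior ⟨e, h⟩ T).1 hT with rfl | rfl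
      · linear_combination h2 + L.beta κ ⟨e, h⟩ * h1
      · linear_combination h2 - (1 - L.beta κ ⟨e, h⟩) * h1
    · rw [L.jumpMean_boundary v h] at h1
      rwa [(L.subset_iff_boundary h T).1 hT]
  funext T
  rw [T.eq_sum_crLocal (v T)]
  exact Finset.sum_eq_zero fun a _ => by rw [hval T _ (T.face_subset a), zero_smul]

theorem localBasis_apply_center {T T' : M.Elem} {e e' : M.Face} (h : e.1 ⊆ T.1)
    (h' : e'.1 ⊆ T'.1) :
    localBasis e T T' e'.center = if T' = T ∧ e' = e then 1 else 0 := by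
  rw [localBasis]
  by_cases hT : T' = T
  · subst hT
    rw [Pi.single_eq_same, T'.crLocal_center e e' (NeZero.ne d) h h']
    simp
  · rw [Pi.single_eq_of_ne hT, if_neg fun hh => hT hh.1]
    rfl

theorem phiCR_apply_center (e : M.InteriorFace) {T : M.Elem} {e' : M.Face} (h : e'.1 ⊆ T.1) :
    L.phiCR e T e'.center = if e' = e.1 then 1 else 0 := by
  change localBasis e.1 (L.plus e.1) T e'.center + localBasis e.1 (L.minus e) T e'.center = _
  rw [localBasis_apply_center (L.subset_plus _) h, localBasis_apply_center (L.subset_minus _) h]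
  by_cases he : e' = e.1
  · subst he
    have hne := L.plus_ne_minus e
    rcases (L.subset_iff_interior e T).1 h with rfl | rfl
    · simp [hne]
    · simp [hne.symm]
  · simp [he]

theorem psiZ_apply_center_of_ne (κ : M.Elem → ℝ) {e e' : M.Face} (hne : e' ≠ e) {T : M.Elem}
    (h : e'.1 ⊆ T.1) : L.psiZ κ e T e'.center = 0 := by
  unfold psiZ
  split_ifs with hi
  · change _ * localBasis e (L.plus e) T e'.center
      - _ * localBasis e (L.minus ⟨e, hi⟩) T e'.center = 0
    rw [localBasis_apply_center (L.subset_plus _) h,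
      localBasis_apply_center (L.subset_minus ⟨e, hi⟩) h]
    simp [hne]
  · rw [localBasis_apply_center (L.subset_plus _) h]
    simp [hne]

theorem psiZ_apply_center_plus (κ : M.Elem → ℝ) (e : M.InteriorFace) :
    L.psiZ κ e.1 (L.plus e.1) e.1.center = L.beta κ e := by
  rw [psiZ, dif_pos e.2]
  change _ * localBasis e.1 (L.plus e.1) (L.plus e.1) e.1.center
      - _ * localBasis e.1 (L.minus e) (L.plus e.1) e.1.center = _
  rw [localBasis_apply_center (L.subset_plus _) (L.subset_plus _),
    localBasis_apply_center (L.subset_minus e) (L.subset_plus _)]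
  simp [L.plus_ne_minus e]
  rfl

theorem psiZ_apply_center_minus (κ : M.Elem → ℝ) (e : M.InteriorFace) :
    L.psiZ κ e.1 (L.minus e) e.1.center = -(1 - L.beta κ e) := by
  rw [psiZ, dif_pos e.2]
  change _ * localBasis e.1 (L.plus e.1) (L.minus e) e.1.center
      - _ * localBasis e.1 (L.minus e) (L.minus e) e.1.center = _
  rw [localBasis_apply_center (L.subset_plus _) (L.subset_minus e),
    localBasis_apply_center (L.subset_minus e) (L.subset_minus e)]
  simp [(L.plus_ne_minus e).symm]
  rfl

/-- The values `β` and `-(1 - β)` of `ψ_e^z` are chosen so that the average with weights `1 - β` and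
`β` cancels while the jump is `β + (1 - β) = 1`. -/
theorem avgMean_psiZ (κ : M.Elem → ℝ) (e : M.Face) (e' : M.InteriorFace) :
    L.avgMean κ (L.psiZ κ e) e' = 0 := by
  rw [avgMean]
  by_cases h : e'.1 = e
  · subst h
    rw [L.psiZ_apply_center_plus, L.psiZ_apply_center_minus]
    ring
  · rw [L.psiZ_apply_center_of_ne κ h (L.subset_plus _),
      L.psiZ_apply_center_of_ne κ h (L.subset_minus _)]
    ring

theorem jumpMean_psiZ (κ : M.Elem → ℝ) (e e' : M.Face) :
    L.jumpMean (L.psiZ κ e) e' = if e' = e then 1 else 0 := by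
  by_cases hi : M.IsInterior e'
  · rw [L.jumpMean_interior _ ⟨e', hi⟩]
    split_ifs with h
    · subst h
      rw [L.psiZ_apply_center_plus κ ⟨e', hi⟩, L.psiZ_apply_center_minus κ ⟨e', hi⟩]
      ring
    · rw [L.psiZ_apply_center_of_ne κ h (L.subset_plus _),
        L.psiZ_apply_center_of_ne κ h (L.subset_minus ⟨e', hi⟩), sub_zero]
  · rw [L.jumpMean_boundary _ hi]
    split_ifs with h
    · subst h
      rw [psiZ, dif_neg hi, localBasis_apply_center (L.subset_plus _) (L.subset_plus _)]
      simp
    · rw [L.psiZ_apply_center_of_ne κ h (L.subset_plus _)]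

theorem jumpMean_phiCR (e : M.InteriorFace) (e' : M.Face) : L.jumpMean (L.phiCR e) e' = 0 := by
  by_cases hi : M.IsInterior e'
  · rw [L.jumpMean_interior _ ⟨e', hi⟩, L.phiCR_apply_center e (L.subset_plus _),
      L.phiCR_apply_center e (L.subset_minus ⟨e', hi⟩), sub_self]
  · rw [L.jumpMean_boundary _ hi, L.phiCR_apply_center e (L.subset_plus _), if_neg]
    rintro rfl
    exact hi e.2

theorem avgMean_phiCR (κ : M.Elem → ℝ) (e e' : M.InteriorFace) :
    L.avgMean κ (L.phiCR e) e' = if e' = e then 1 else 0 := by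
  rw [avgMean, L.phiCR_apply_center e (L.subset_plus _),
    L.phiCR_apply_center e (L.subset_minus e')]
  by_cases h : e' = e
  · subst h
    simp
  · rw [if_neg h, if_neg fun hh => h (Subtype.ext hh)]
    ring

theorem coordMap_psiZ (κ : M.Elem → ℝ) (e : M.Face) :
    L.coordMap κ (L.psiZ κ e) = Pi.single (Sum.inl e) 1 := by
  ext (e' | e')
  · rw [coordMap_inl, jumpMean_psiZ, Pi.single_apply]
    simp
  · rw [coordMap_inr, avgMean_psiZ, Pi.single_apply]
    simp

theorem coordMap_phiCR (κ : M.Elem → ℝ) (e : M.InteriorFace) :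
    L.coordMap κ (L.phiCR e) = Pi.single (Sum.inr e) 1 := by
  ext (e' | e')
  · rw [coordMap_inl, jumpMean_phiCR, Pi.single_apply]
    simp
  · rw [coordMap_inr, avgMean_phiCR, Pi.single_apply]
    simp

theorem coordMap_surjective (κ : M.Elem → ℝ) : Function.Surjective (L.coordMap κ) := by
  rw [← LinearMap.range_eq_top, eq_top_iff, ← (Pi.basisFun ℝ _).span_eq, Submodule.span_le]
  rintro _ ⟨e | e, rfl⟩
  · exact ⟨L.psiZ κ e, by rw [coordMap_psiZ, Pi.basisFun_apply]⟩
  · exact ⟨L.phiCR e, by rw [coordMap_phiCR, Pi.basisFun_apply]⟩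

/-- The basis of `V_h^DG` formed by the functions `ψ_e^z` and `φ_e^CR`. -/
def basisDG (κ : M.Elem → ℝ) : Module.Basis (M.Face ⊕ M.InteriorFace) ℝ M.DG :=
  Module.Basis.ofEquivFun
    (LinearEquiv.ofBijective (L.coordMap κ) ⟨L.coordMap_injective κ, L.coordMap_surjective κ⟩)

theorem coordMap_basisDG (κ : M.Elem → ℝ) (i : M.Face ⊕ M.InteriorFace) :
    L.coordMap κ (L.basisDG κ i) = Pi.single i 1 := by
  rw [basisDG, Module.Basis.coe_ofEquivFun]
  exact (LinearEquiv.ofBijective (L.coordMap κ)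
    ⟨L.coordMap_injective κ, L.coordMap_surjective κ⟩).apply_symm_apply (Pi.single i 1)

theorem basisDG_inl (κ : M.Elem → ℝ) (e : M.Face) : L.basisDG κ (Sum.inl e) = L.psiZ κ e :=
  L.coordMap_injective κ (by rw [coordMap_basisDG, coordMap_psiZ])

theorem basisDG_inr (κ : M.Elem → ℝ) (e : M.InteriorFace) :
    L.basisDG κ (Sum.inr e) = L.phiCR e :=
  L.coordMap_injective κ (by rw [coordMap_basisDG, coordMap_phiCR])

/-- The basis is dual to the coordinates, so these are the coefficients. The spans and the splitting
are read off from this expansion. -/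
theorem eq_sum_add_sum (κ : M.Elem → ℝ) (u : M.DG) :
    u = ∑ e : M.InteriorFace, L.avgMean κ u e • L.phiCR e +
      ∑ e : M.Face, L.jumpMean u e • L.psiZ κ e := by
  have h := (L.basisDG κ).sum_equivFun u
  rw [Fintype.sum_sum_type] at h
  simp_rw [basisDG_inl, basisDG_inr] at h
  conv_lhs => rw [← h, add_comm]
  rw [basisDG, Module.Basis.equivFun_ofEquivFun]
  rfl

theorem phiCR_mem_VCR (e : M.InteriorFace) : L.phiCR e ∈ L.VCR :=
  (L.mem_VCR_iff _).2 (L.jumpMean_phiCR e)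

theorem psiZ_mem_Zbeta (κ : M.Elem → ℝ) (e : M.Face) : L.psiZ κ e ∈ L.Zbeta κ :=
  (L.mem_Zbeta_iff κ _).2 (L.avgMean_psiZ κ e)

/-- `VCR` is only a set by definition; the kernel form supplies the subspace structure used for the
span. -/
theorem VCR_eq_ker (κ : M.Elem → ℝ) :
    L.VCR = (LinearMap.ker (LinearMap.funLeft ℝ ℝ Sum.inl ∘ₗ L.coordMap κ) : Set M.DG) := by
  ext v
  rw [L.mem_VCR_iff, SetLike.mem_coe, LinearMap.mem_ker, funext_iff]
  rfl

theorem Zbeta_eq_ker (κ : M.Elem → ℝ) :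
    L.Zbeta κ = (LinearMap.ker (LinearMap.funLeft ℝ ℝ Sum.inr ∘ₗ L.coordMap κ) : Set M.DG) := by
  ext v
  rw [L.mem_Zbeta_iff, SetLike.mem_coe, LinearMap.mem_ker, funext_iff]
  rfl

theorem span_phiCR : (Submodule.span ℝ (Set.range L.phiCR) : Set M.DG) = L.VCR := by
  refine Set.Subset.antisymm ?_ fun v hv => ?_
  -- Jumps do not involve the weights, so any coefficient can complete them to coordinates; 0 is
  -- taken.
  · rw [L.VCR_eq_ker 0, SetLike.coe_subset_coe, Submodule.span_le, ← L.VCR_eq_ker 0]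
    rintro _ ⟨e, rfl⟩
    exact L.phiCR_mem_VCR e
  · rw [L.mem_VCR_iff] at hv
    rw [L.eq_sum_add_sum 0 v]
    simp only [hv, zero_smul, Finset.sum_const_zero, add_zero]
    exact Submodule.sum_mem _ fun e _ => Submodule.smul_mem _ _ (Submodule.subset_span ⟨e, rfl⟩)

theorem span_psiZ (κ : M.Elem → ℝ) :
    (Submodule.span ℝ (Set.range (L.psiZ κ)) : Set M.DG) = L.Zbeta κ := by
  refine Set.Subset.antisymm ?_ fun v hv => ?_
  · rw [L.Zbeta_eq_ker κ, SetLike.coe_subset_coe, Submodule.span_le, ← L.Zbeta_eq_ker κ]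
    rintro _ ⟨e, rfl⟩
    exact L.psiZ_mem_Zbeta κ e
  · rw [L.mem_Zbeta_iff] at hv
    rw [L.eq_sum_add_sum κ v]
    simp only [hv, zero_smul, Finset.sum_const_zero, zero_add]
    exact Submodule.sum_mem _ fun e _ => Submodule.smul_mem _ _ (Submodule.subset_span ⟨e, rfl⟩)

theorem existsUnique_decomposition (κ : M.Elem → ℝ) (u : M.DG) :
    ∃! p : M.DG × M.DG, p.1 ∈ L.VCR ∧ p.2 ∈ L.Zbeta κ ∧ u = p.1 + p.2 := by
  refine ⟨(∑ e : M.InteriorFace, L.avgMean κ u e • L.phiCR e,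
    ∑ e : M.Face, L.jumpMean u e • L.psiZ κ e), ⟨?_, ?_, L.eq_sum_add_sum κ u⟩, ?_⟩
  · rw [← L.span_phiCR]
    exact Submodule.sum_mem _ fun e _ => Submodule.smul_mem _ _ (Submodule.subset_span ⟨e, rfl⟩)
  · rw [← L.span_psiZ]
    exact Submodule.sum_mem _ fun e _ => Submodule.smul_mem _ _ (Submodule.subset_span ⟨e, rfl⟩)
  · rintro ⟨v, z⟩ ⟨hv, hz, rfl⟩
    dsimp only at hv hz ⊢
    rw [L.mem_VCR_iff] at hv
    rw [L.mem_Zbeta_iff] at hz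
    -- Uniqueness: averages do not see `z` and jumps do not see `v`, so the two sums recover `v` and
    -- `z`.
    have h1 : ∀ e, L.avgMean κ (v + z) e = L.avgMean κ v e := fun e => by
      rw [← coordMap_inr, map_add, Pi.add_apply, coordMap_inr, coordMap_inr, hz, add_zero]
    have h2 : ∀ e, L.jumpMean (v + z) e = L.jumpMean z e := fun e => by
      rw [← L.coordMap_inl κ, map_add, Pi.add_apply, coordMap_inl, coordMap_inl, hv, zero_add]
    have h3 := L.eq_sum_add_sum κ v
    have h4 := L.eq_sum_add_sum κ z
    simp only [hv, zero_smul, Finset.sum_const_zero, add_zero] at h3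
    simp only [hz, zero_smul, Finset.sum_const_zero, zero_add] at h4
    simp_rw [h1, h2]
    rw [← h3, ← h4]

/-- The zero block has Crouzeix-Raviart trial and `Zbeta` test functions, exactly the one-sided
orthogonality `A0_VCR_Zbeta`. -/
theorem stiffness_basisDG (κ : M.Elem → ℝ) (α θ : ℝ) :
    L.stiffness κ α θ (L.basisDG κ) = Matrix.fromBlocks
      (Matrix.of fun e' e => L.A0 κ α θ (L.psiZ κ e) (L.psiZ κ e')) 0
      (Matrix.of fun e' e => L.A0 κ α θ (L.psiZ κ e) (L.phiCR e'))
      (Matrix.of fun e' e => L.A0 κ α θ (L.phiCR e) (L.phiCR e')) := by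
  ext (e' | e') (e | e)
  · simp [stiffness, basisDG_inl]
  · simp [stiffness, basisDG_inl, basisDG_inr,
      L.A0_VCR_Zbeta κ α θ (L.phiCR_mem_VCR e) (L.psiZ_mem_Zbeta κ e')]
  · simp [stiffness, basisDG_inl, basisDG_inr]
  · simp [stiffness, basisDG_inr]

end Labelling

end SimplicialMesh
end IPDG

end

theorem lemma3p2 {d : ℕ} (hd : d = 2 ∨ d = 3) (M : IPDG.SimplicialMesh d) (L : M.Labelling)
    (κ : M.Elem → ℝ) (hκ : ∀ T, 0 < κ T) (α : ℝ) (hα : 0 < α)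
    (θ : ℝ) (hθ : θ = -1 ∨ θ = 0 ∨ θ = 1) :
    (∀ v ∈ L.VCR, ∀ z ∈ L.Zbeta κ, L.A0 κ α θ v z = 0) ∧
    (∃ b : Module.Basis (M.Face ⊕ M.InteriorFace) ℝ M.DG,
      (∀ e, b (Sum.inl e) = L.psiZ κ e) ∧ (∀ e, b (Sum.inr e) = L.phiCR e) ∧
      (Submodule.span ℝ (Set.range (L.psiZ κ)) : Set M.DG) = L.Zbeta κ ∧
      (Submodule.span ℝ (Set.range L.phiCR) : Set M.DG) = L.VCR ∧
      L.stiffness κ α θ b = Matrix.fromBlocks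
        (Matrix.of fun e' e => L.A0 κ α θ (L.psiZ κ e) (L.psiZ κ e'))
        0
        (Matrix.of fun e' e => L.A0 κ α θ (L.psiZ κ e) (L.phiCR e'))
        (Matrix.of fun e' e => L.A0 κ α θ (L.phiCR e) (L.phiCR e'))) ∧
    (∀ u : M.DG, ∃! p : M.DG × M.DG, p.1 ∈ L.VCR ∧ p.2 ∈ L.Zbeta κ ∧ u = p.1 + p.2) ∧
    (θ = -1 → ∀ u w : M.DG, L.A0 κ α θ u w = L.A0 κ α θ w u) ∧
    ((∀ u w : M.DG, L.A0 κ α θ u w = L.A0 κ α θ w u) →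
      ∀ v ∈ L.VCR, ∀ z ∈ L.Zbeta κ, L.A0 κ α θ v z = 0 ∧ L.A0 κ α θ z v = 0) := by
  have : NeZero d := ⟨by omega⟩
  refine ⟨fun v hv z hz => L.A0_VCR_Zbeta κ α θ hv hz, ⟨L.basisDG κ, L.basisDG_inl κ,
    L.basisDG_inr κ, L.span_psiZ κ, L.span_phiCR, L.stiffness_basisDG κ α θ⟩,
    L.existsUnique_decomposition κ, ?_, fun hsymm v hv z hz => ?_⟩
  · rintro rfl u w
    exact L.A0_symm κ α u w
  · have h := L.A0_VCR_Zbeta κ α θ hv hz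
    exact ⟨h, by rw [hsymm, h]⟩
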